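/- Let $\mathcal T$ be a normal (face-to-face) tiling of $\mathbb R^d$ by translates of a $d$-dimensional convex polytope $P$ (so $P$ is a parallelohedron): the cells cover $\mathbb R^d$, have pairwise disjoint interiors, and the intersection of two distinct cells is empty or a face of both. A *facet* of $\mathcal T$ is a $(d-1)$-dimensional face of a cell; two cells are *adjacent* if they have a common facet. A *canonical scaling* of $\mathcal T$ is a function $s$ assigning a positive real number to each facet of $\mathcal T$ such that for every $(d-2)$-dimensional face $G$ of $\mathcal T$ one has $\sum_{F\supset G}s(F)\,\mathbf n_F=0$, where $F$ runs over the facets of $\mathcal T$ containing $G$ and the unit normals $\mathbf n_F$ to $F$ are all directed according to one and the same direction of going around $G$ (that is, in the projection along $G$ to the orthogonal plane, each $\mathbf n_F$ points to the counterclockwise side of the segment onto which $F$ is projected, for a fixed orientation of the plane; the choice of the orientation only changes the sign of the sum). The scaling $s$ is *translation invariant* if $s(F+t)=s(F)$ for all facets $F$ and all translations $t$ that map $\mathcal T$ to itself. Let $s$ be a translation-invariant canonical scaling of $\mathcal T$. Fix a cell $P_0$ of $\mathcal T$, and let $P_1,\dots,P_k$ be all the cells adjacent to $P_0$ (each listed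 once). Let $\mathbf p_i=c(P_i)-c(P_0)$, where $c(C)$ denotes the center of a cell $C$, let $\mathbf n_{0,i}$ be the unit normal to the facet $P_0\cap P_i$ directed from $P_0$ to $P_i$, and let $\mathbf m_i=s(P_0\cap P_i)\,\mathbf n_{0,i}$. Let $\mathcal P=(\mathbf p_1|\dots|\mathbf p_k)$ and $\mathcal M=(\mathbf m_1|\dots|\mathbf m_k)$ be the $d\times k$ matrices with columns $\mathbf p_i$ and $\mathbf m_i$ respectively. Then there exists a unique symmetric nondegenerate real $d\times d$ matrix $Q$ such that $\mathcal M=Q\mathcal P$. -/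

import Mathlib

open scoped Pointwise InnerProductSpace

namespace Parallelohedra

/-- Euclidean space of dimension `d`. -/
abbrev E (d : ℕ) : Type := EuclideanSpace ℝ (Fin d)

/-- A `d`-dimensional convex polytope in `d`-dimensional space. -/
def IsFullPolytope {d : ℕ} (C : Set (E d)) : Prop :=
  (∃ S : Finset (E d), C = convexHull ℝ (S : Set (E d))) ∧ (interior C).Nonempty

/-- `F` is a nonempty face of the convex polytope `C` (possibly `C` itself): the set of maximum
points on `C` of a linear functional. -/
def IsFace {d : ℕ} (C F : Set (E d)) : Prop :=
  F.Nonempty ∧ IsExposed ℝ C F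

/-- The dimension of the affine hull of a nonempty set. -/
noncomputable def dim {d : ℕ} (F : Set (E d)) : ℕ :=
  Module.finrank ℝ (vectorSpan ℝ F)

/-- `F` is a hyperface, that is a `(d-1)`-dimensional face, of `C`. -/
def IsFacet {d : ℕ} (C F : Set (E d)) : Prop :=
  IsFace C F ∧ dim F + 1 = d

/-- `G` is a `(d-2)`-dimensional face of `C`. -/
def IsRidge {d : ℕ} (C G : Set (E d)) : Prop :=
  IsFace C G ∧ dim G + 2 = d

/-- A normal (face-to-face) tiling of `d`-dimensional space by convex `d`-polytopes; `T` is the set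
of its cells. -/
structure IsNormalTiling {d : ℕ} (T : Set (Set (E d))) : Prop where
  polytope : ∀ C ∈ T, IsFullPolytope C
  cover : ⋃₀ T = Set.univ
  disjoint_interior : T.Pairwise fun C C' => Disjoint (interior C) (interior C')
  face_to_face : T.Pairwise fun C C' =>
    C ∩ C' = ∅ ∨ (IsFace C (C ∩ C') ∧ IsFace C' (C ∩ C'))

/-- `T` is a normal tiling of space by translates of `P`; that is, `P` is a parallelohedron and
`T` is a tiling corresponding to it. -/
structure IsParallelohedralTiling {d : ℕ} (P : Set (E d)) (T : Set (Set (E d))) : Prop where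
  tiling : IsNormalTiling T
  translates : ∀ C ∈ T, ∃ t : E d, C = t +ᵥ P

/-- The hyperfaces of the tiling. -/
def facets {d : ℕ} (T : Set (Set (E d))) : Set (Set (E d)) :=
  {F | ∃ C ∈ T, IsFacet C F}

/-- The `(d-2)`-faces of the tiling. -/
def ridges {d : ℕ} (T : Set (Set (E d))) : Set (Set (E d)) :=
  {G | ∃ C ∈ T, IsRidge C G}

/-- The hyperfaces of the tiling that contain `G`. -/
def facetsContaining {d : ℕ} (T : Set (Set (E d))) (G : Set (E d)) : Set (Set (E d)) :=
  {F | F ∈ facets T ∧ G ⊆ F}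

/-- Two cells are adjacent if they have a common hyperface. -/
def Adjacent {d : ℕ} (C C' : Set (E d)) : Prop :=
  IsFacet C (C ∩ C') ∧ IsFacet C' (C ∩ C')

/-- `v` is a unit normal to the hyperface `F`. -/
def IsUnitNormal {d : ℕ} (F : Set (E d)) (v : E d) : Prop :=
  ‖v‖ = 1 ∧ ∀ w ∈ vectorSpan ℝ F, ⟪v, w⟫_ℝ = 0

/-- `v` is the unit normal to the common hyperface of the adjacent cells `C` and `C'`, directed
from `C` to `C'`. -/
def IsUnitNormalFromTo {d : ℕ} (C C' : Set (E d)) (v : E d) : Prop :=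
  IsUnitNormal (C ∩ C') v ∧
    ∀ x ∈ C ∩ C', (∀ y ∈ C, ⟪v, y - x⟫_ℝ ≤ 0) ∧ ∀ z ∈ C', 0 ≤ ⟪v, z - x⟫_ℝ

/-- `(e₁, e₂)` is an orthonormal basis of the plane orthogonal to the `(d-2)`-face `G`. Such a
basis fixes one of the two directions of going around `G`: counterclockwise in the coordinates
`(⟪e₁, ·⟫, ⟪e₂, ·⟫)`. -/
def IsFrameAround {d : ℕ} (G : Set (E d)) (e₁ e₂ : E d) : Prop :=
  Orthonormal ℝ ![e₁, e₂] ∧ Submodule.span ℝ {e₁, e₂} = (vectorSpan ℝ G)ᗮ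

/-- The unit normals `n F` to the hyperfaces `F` around the `(d-2)`-face `G` agree with the
direction of going around `G` fixed by `(e₁, e₂)`: in the projection along `G` each hyperface `F`
is seen as a segment issuing from the image of `G`, and `n F` points to the counterclockwise side
of it. -/
def AreCoherentNormals {d : ℕ} (T : Set (Set (E d))) (G : Set (E d)) (e₁ e₂ : E d)
    (n : Set (E d) → E d) : Prop :=
  ∀ F ∈ facetsContaining T G, IsUnitNormal F (n F) ∧
    ∀ g ∈ G, ∀ x ∈ F \ G,
      0 < ⟪e₁, x - g⟫_ℝ * ⟪e₂, n F⟫_ℝ - ⟪e₂, x - g⟫_ℝ * ⟪e₁, n F⟫_ℝ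

/-- The torsion of the scaling `s` around the `(d-2)`-face `G`, for a given choice `n` of the
unit normals to the hyperfaces around `G`. -/
noncomputable def torsion {d : ℕ} (T : Set (Set (E d))) (s : Set (E d) → ℝ) (G : Set (E d))
    (n : Set (E d) → E d) : E d :=
  ∑ᶠ F ∈ facetsContaining T G, s F • n F

/-- `s` is a canonical scaling of the tiling: it is positive on the hyperfaces and has zero torsion
around every `(d-2)`-face. Only the values of `s` on the hyperfaces of the tiling matter. -/
structure IsCanonicalScaling {d : ℕ} (T : Set (Set (E d))) (s : Set (E d) → ℝ) : Prop where
  pos : ∀ F ∈ facets T, 0 < s F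
  torsion_eq_zero : ∀ G ∈ ridges T, ∀ e₁ e₂ : E d, IsFrameAround G e₁ e₂ →
    ∀ n : Set (E d) → E d, AreCoherentNormals T G e₁ e₂ n → torsion T s G n = 0

/-- The scaling `s` is preserved by all translations that preserve the tiling. -/
def IsTranslationInvariant {d : ℕ} (T : Set (Set (E d))) (s : Set (E d) → ℝ) : Prop :=
  ∀ t : E d, (fun C : Set (E d) => t +ᵥ C) '' T = T → ∀ F ∈ facets T, s (t +ᵥ F) = s F

/-- The center of a cell, defined as its centroid. For a centrally symmetric cell this is the
center of symmetry, see `cellCenter_eq_of_symmetric`. -/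
noncomputable def cellCenter {d : ℕ} (C : Set (E d)) : E d :=
  ⨍ x in C, x ∂MeasureTheory.volume

/-- The matrix with columns `v 0, …, v (k-1)`. -/
def columnMatrix {d k : ℕ} (v : Fin k → E d) : Matrix (Fin d) (Fin k) ℝ :=
  Matrix.of fun a i => v i a

theorem IsFullPolytope.isCompact {d : ℕ} {C : Set (E d)} (hC : IsFullPolytope C) :
    IsCompact C := by
  obtain ⟨⟨S, rfl⟩, -⟩ := hC
  exact S.finite_toSet.isCompact_convexHull ℝ

theorem cellCenter_eq_of_symmetric {d : ℕ} {C : Set (E d)} (hC : IsFullPolytope C) (c : E d)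
    (hc : ∀ x ∈ C, (c + c) - x ∈ C) : cellCenter C = c := by
  have hcomp := hC.isCompact
  have hfin : MeasureTheory.volume C ≠ ⊤ := hcomp.measure_ne_top
  have hpos : MeasureTheory.volume C ≠ 0 := by
    have h := isOpen_interior.measure_pos MeasureTheory.volume hC.2
    exact (lt_of_lt_of_le h (MeasureTheory.measure_mono interior_subset)).ne'
  have hint : MeasureTheory.IntegrableOn (fun x : E d => x) C :=
    continuous_id.continuousOn.integrableOn_compact hcomp
  have hconst : ∀ v : E d, MeasureTheory.IntegrableOn (fun _ : E d => v) C :=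
    fun v => MeasureTheory.integrableOn_const hfin
  have hmp := MeasureTheory.Measure.measurePreserving_sub_left
    (MeasureTheory.volume : MeasureTheory.Measure (E d)) (c + c)
  have hpre : (fun x : E d => (c + c) - x) ⁻¹' C = C := by
    ext x
    refine ⟨fun h => ?_, fun h => hc x h⟩
    have := hc _ h
    simpa using this
  have key : ∫ x in C, ((c + c) - x) = ∫ x in C, x := by
    have h := hmp.setIntegral_preimage_emb
      (MeasurableEquiv.subLeft (c + c)).measurableEmbedding (fun x : E d => x) C
    rw [hpre] at h
    exact h
  rw [MeasureTheory.integral_sub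
    (hconst _) hint, MeasureTheory.setIntegral_const] at key
  have hr : MeasureTheory.volume.real C ≠ 0 := by
    simp [MeasureTheory.Measure.real, ENNReal.toReal_eq_zero_iff, hpos, hfin]
  have h2 : (∫ x in C, x) = MeasureTheory.volume.real C • c := by
    have h3 : (2 : ℝ) • (∫ x in C, x) = (2 : ℝ) • (MeasureTheory.volume.real C • c) := by
      rw [two_smul, two_smul, ← smul_add]
      exact (sub_eq_iff_eq_add.mp key).symm
    exact smul_right_injective _ (two_ne_zero) h3
  rw [cellCenter, MeasureTheory.setAverage_eq, h2, smul_smul, inv_mul_cancel₀ hr, one_smul]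

theorem cellCenter_vadd {d : ℕ} {C : Set (E d)} (hC : IsFullPolytope C) (t : E d) :
    cellCenter (t +ᵥ C) = t + cellCenter C := by
  have hcomp := hC.isCompact
  have hfin : MeasureTheory.volume C ≠ ⊤ := hcomp.measure_ne_top
  have hpos : MeasureTheory.volume C ≠ 0 := by
    have h := isOpen_interior.measure_pos MeasureTheory.volume hC.2
    exact (lt_of_lt_of_le h (MeasureTheory.measure_mono interior_subset)).ne'
  have hint : MeasureTheory.IntegrableOn (fun x : E d => x) C :=
    continuous_id.continuousOn.integrableOn_compact hcomp
  have hconst : ∀ v : E d, MeasureTheory.IntegrableOn (fun _ : E d => v) C :=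
    fun v => MeasureTheory.integrableOn_const hfin
  have hr : MeasureTheory.volume.real C ≠ 0 := by
    simp [MeasureTheory.Measure.real, ENNReal.toReal_eq_zero_iff, hpos, hfin]
  have hv : MeasureTheory.volume.real (t +ᵥ C) = MeasureTheory.volume.real C := by
    simp [MeasureTheory.Measure.real, MeasureTheory.measure_vadd]
  have himg : t +ᵥ C = (fun x : E d => t + x) '' C := rfl
  have key : ∫ x in t +ᵥ C, x = ∫ x in C, (t + x) := by
    rw [himg]
    exact (MeasureTheory.measurePreserving_add_left MeasureTheory.volume t).setIntegral_image_emb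
      (MeasurableEquiv.addLeft t).measurableEmbedding (fun x : E d => x) C
  rw [cellCenter, cellCenter, MeasureTheory.setAverage_eq, MeasureTheory.setAverage_eq, hv, key,
    MeasureTheory.integral_add (hconst _) hint,
    MeasureTheory.setIntegral_const, smul_add, smul_smul, inv_mul_cancel₀ hr, one_smul]

end Parallelohedra

namespace Parallelohedra

open Filter Topology

/-! A canonical scaling is the system of gradient jumps of a continuous piecewise affine function.
There are vectors `g C` and numbers `h C` such that, across a facet `F` with unit normal `n` from
`C` to `D`, the gradient jumps by `s F • n` and the functions `⟪g C, x⟫ + h C` and `⟪g D, x⟫ + h D`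
agree on `F` (`IsCanonicalScaling.exists_gradient`).

To build it, fix a generic base point `a` and add up the jumps over all facets crossed by the
segment from `a` to a generic point `x` (`crossSum`), normals pointing away from `a`. When `x` moves
generically inside a cell, the segment avoids faces of codimension three. When it sweeps over a
ridge, the crossed facets on one side of the ridge are exchanged for those on the other side. Zero
torsion says that both groups have the same sum, so the result depends only on the cell
(`crossSum_eq_of_mem_interior`), and it changes by exactly one jump from a cell to its neighbour
(`exists_crossSum_jump`).

If `t` preserves the tiling, invariance of `s` and connectedness of the adjacency graph show that `g
(t + C) - g C` is a vector `q t` independent of `C`, and that `h` changes accordingly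
(`exists_quasiperiod`). Computing `h (t + u + C₀)` in both orders gives `⟪q t, u⟫ = ⟪q u, t⟫`. The
translations span the space, so `q` is the restriction of a symmetric linear map `L`
(`exists_isSymmetric`), and `L` sends each `p i` to the gradient jump `m i`. The matrix of `L` is
`Q`.

The facet normals of a bounded cell span the space, hence `M` has full row rank. This gives both
nondegeneracy and uniqueness. -/

/-! ### Faces of convex sets and polytopes -/

/-- `p` has a neighbourhood in the affine hull of `K` that is contained in `K`. -/
def IsRelInterior {d : ℕ} (K : Set (E d)) (p : E d) : Prop :=
  ∃ r > 0, ∀ v ∈ vectorSpan ℝ K, ‖v‖ < r → p + v ∈ K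

theorem IsRelInterior.mem {d : ℕ} {K : Set (E d)} {p : E d} (h : IsRelInterior K p) : p ∈ K := by
  obtain ⟨r, hr, h⟩ := h
  simpa using h 0 (zero_mem _) (by simpa using hr)

theorem isRelInterior_of_mem_interior {d : ℕ} {K : Set (E d)} {p : E d} (h : p ∈ interior K) :
    IsRelInterior K p := by
  obtain ⟨r, hr, hb⟩ := Metric.isOpen_iff.1 isOpen_interior p h
  refine ⟨r, hr, fun v _ hv => interior_subset (hb ?_)⟩
  simpa [Metric.mem_ball, dist_eq_norm] using hv

theorem exists_isRelInterior {d : ℕ} {K : Set (E d)} (hK : Convex ℝ K) (hne : K.Nonempty) :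
    ∃ p, IsRelInterior K p := by
  obtain ⟨p, hp⟩ := hne.intrinsicInterior hK
  obtain ⟨y, hy, rfl⟩ := mem_intrinsicInterior.1 hp
  obtain ⟨r, hr, hb⟩ := Metric.isOpen_iff.1 isOpen_interior y hy
  refine ⟨y, r, hr, fun v hv hvr => ?_⟩
  have hmem : (y : E d) + v ∈ affineSpan ℝ K := by
    have := AffineSubspace.vadd_mem_of_mem_direction (s := affineSpan ℝ K)
      (by rwa [direction_affineSpan]) y.2
    rwa [vadd_eq_add, add_comm] at this
  have : (⟨(y : E d) + v, hmem⟩ : affineSpan ℝ K) ∈ Metric.ball y r := by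
    rw [Metric.mem_ball, Subtype.dist_eq, dist_eq_norm]
    simpa using hvr
  have h2 := interior_subset (hb this)
  exact h2

/-- A functional that is maximal at `p` is constant on `K`: from `p` one can step a little away from
any `y` in `K` without leaving `K`, so a smaller value at `y` would give a larger one at the step.
-/
theorem IsRelInterior.eq_of_isExposed {d : ℕ} {K G : Set (E d)} {p : E d} (h : IsRelInterior K p)
    (hG : IsExposed ℝ K G) (hp : p ∈ G) : G = K := by
  obtain ⟨l, rfl⟩ := hG ⟨p, hp⟩
  refine Set.Subset.antisymm (fun x hx => hx.1) fun y hy => ⟨hy, fun z hz => ?_⟩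
  obtain ⟨r, hr, h⟩ := h
  have hv : y - p ∈ vectorSpan ℝ K := vsub_mem_vectorSpan ℝ hy hp.1
  obtain ⟨ε, hε, hεr⟩ : ∃ ε > 0, ε * ‖y - p‖ < r := by
    refine ⟨r / (‖y - p‖ + 1), by positivity, ?_⟩
    rw [div_mul_eq_mul_div, div_lt_iff₀ (by positivity)]
    nlinarith
  have h1 := hp.2 _ (h (-(ε • (y - p))) (neg_mem (Submodule.smul_mem _ _ hv))
    (by rwa [norm_neg, norm_smul, Real.norm_of_nonneg hε.le]))
  simp only [map_add, map_neg, map_smul, map_sub, smul_eq_mul] at h1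
  have h2 := hp.2 _ hz
  nlinarith

/-- A point of a convex set which lies in no proper exposed face is a relative interior point. -/
theorem isRelInterior_of_forall_isExposed {d : ℕ} {K : Set (E d)} (hK : Convex ℝ K) {p : E d}
    (hp : p ∈ K) (h : ∀ G, IsExposed ℝ K G → p ∈ G → G = K) : IsRelInterior K p := by
  obtain ⟨z, hz⟩ := exists_isRelInterior hK ⟨p, hp⟩
  have hzK := hz.mem
  obtain ⟨ρ, hρ, hz⟩ := hz
  set W := vectorSpan ℝ K with hW
  -- `K'` is `K` seen inside its direction space with `p` as origin. There it has nonempty interior,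
  -- so the usual separation theorem applies.
  let K' : Set W := {v | p + (v : E d) ∈ K}
  have hK' : Convex ℝ K' := by
    intro v hv w hw a b ha hb hab
    have := hK hv hw ha hb hab
    change p + ((a • v + b • w : W) : E d) ∈ K
    convert this using 1
    rw [smul_add, smul_add, add_add_add_comm, ← add_smul, hab, one_smul]
    simp
  let z' : W := ⟨z - p, vsub_mem_vectorSpan ℝ hzK hp⟩
  have hz' : z' ∈ interior K' := by
    rw [mem_interior]
    refine ⟨Metric.ball z' ρ, fun v hv => ?_, Metric.isOpen_ball, Metric.mem_ball_self hρ⟩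
    have := hz ((v - z' : W) : E d) (v - z').2 (by simpa [Metric.mem_ball, dist_eq_norm] using hv)
    change p + (v : E d) ∈ K
    convert this using 1
    simp only [z', AddSubgroupClass.coe_sub]
    abel
  by_cases h0 : (0 : W) ∈ interior K'
  · obtain ⟨r, hr, hb⟩ := Metric.isOpen_iff.1 isOpen_interior _ h0
    refine ⟨r, hr, fun v hv hvr => ?_⟩
    have : (⟨v, hv⟩ : W) ∈ K' := interior_subset (hb (by simpa [Metric.mem_ball] using hvr))
    exact this
  · exfalso
    obtain ⟨f, hf⟩ := geometric_hahn_banach_open_point hK'.interior isOpen_interior h0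
    rw [map_zero] at hf
    have hcl : ∀ v ∈ K', f v ≤ 0 := by
      intro v hv
      have hv' : v ∈ closure (interior K') := by
        rw [hK'.closure_interior_eq_closure_of_nonempty_interior ⟨z', hz'⟩]
        exact subset_closure hv
      exact closure_minimal (fun a ha => (hf a ha).le)
        (isClosed_le f.continuous continuous_const) hv'
    -- Extended by orthogonal projection, the separating functional exposes a face through `p` that
    -- misses the relative interior point `z`.
    let L : StrongDual ℝ (E d) := f.comp W.orthogonalProjectionOnto
    have hL : ∀ y (hy : y ∈ K), L y - L p = f ⟨y - p, vsub_mem_vectorSpan ℝ hy hp⟩ := by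
      intro y hy
      rw [← map_sub]
      change f (W.orthogonalProjectionOnto (y - p)) = _
      congr 1
      exact Submodule.orthogonalProjectionOnto_mem_subspace_eq_self
        (⟨y - p, vsub_mem_vectorSpan ℝ hy hp⟩ : W)
    have hLp : ∀ y ∈ K, L y ≤ L p := fun y hy => by
      have := hcl ⟨y - p, vsub_mem_vectorSpan ℝ hy hp⟩ (by simpa [K'] using hy)
      linarith [hL y hy]
    have hG := h (L.toExposed K) ContinuousLinearMap.toExposed.isExposed ⟨hp, hLp⟩
    have hzG : z ∈ L.toExposed K := by rw [hG]; exact hzK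
    have := hzG.2 p hp
    have h2 := hf _ hz'
    linarith [hL z hzK]

/-- A convex set containing a neighbourhood of `p` in `p + V` and a point `q` contains a
neighbourhood of `p` in the cone over `V` and `q - p`. -/
theorem exists_half_ball_subset {d : ℕ} {A : Set (E d)} (hA : Convex ℝ A) {p q : E d}
    {V : Submodule ℝ (E d)} {r : ℝ} (hr : 0 < r) (hV : ∀ v ∈ V, ‖v‖ < r → p + v ∈ A) (hq : q ∈ A)
    (μ : StrongDual ℝ (E d)) (hμ : ∀ v ∈ V, μ v = 0) (hμq : μ (q - p) ≠ 0) :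
    ∃ r' > 0, ∀ v ∈ V, ∀ τ : ℝ, 0 ≤ τ → ‖v + τ • (q - p)‖ < r' → p + (v + τ • (q - p)) ∈ A := by
  set u := q - p with hu
  have hc : 0 < |μ u| := abs_pos.2 hμq
  set N := ‖μ‖ / |μ u| with hN
  have hN0 : 0 ≤ N := by positivity
  set M := 1 + N * ‖u‖ with hM
  have hM0 : 0 < M := by positivity
  -- Since `μ` sees only the `u`-component, `τ ≤ N * ‖w‖`. The two bounds then force `‖v‖ < r / 2`
  -- and `τ < 1 / 2`, so `p + w` is a convex combination of `p + (1 - τ)⁻¹ • v` and `q`.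
  refine ⟨min (r / (2 * M)) (1 / (2 * (N + 1))), by positivity, fun v hv τ hτ hlt => ?_⟩
  obtain ⟨h1, h2⟩ := lt_min_iff.1 hlt
  set w := v + τ • u with hw
  have hτN : τ ≤ N * ‖w‖ := by
    have h3 : μ w = τ * μ u := by simp [hw, hμ v hv]
    have h4 : |μ w| ≤ ‖μ‖ * ‖w‖ := μ.le_opNorm w
    rw [h3, abs_mul, abs_of_nonneg hτ] at h4
    rw [hN, div_mul_eq_mul_div, le_div_iff₀ hc]
    exact h4
  have hτ2 : τ < 1 / 2 := by
    rw [lt_div_iff₀ (by positivity)] at h2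
    nlinarith [norm_nonneg w]
  have hvn : ‖v‖ < r / 2 := by
    have h5 : ‖v‖ ≤ ‖w‖ + τ * ‖u‖ := by
      have : v = w - τ • u := by simp [hw]
      calc ‖v‖ = ‖w - τ • u‖ := by rw [← this]
        _ ≤ ‖w‖ + ‖τ • u‖ := norm_sub_le _ _
        _ = _ := by rw [norm_smul, Real.norm_of_nonneg hτ]
    have h6 : ‖v‖ ≤ M * ‖w‖ := by
      have := mul_le_mul_of_nonneg_right hτN (norm_nonneg u)
      rw [hM]; linarith
    rw [lt_div_iff₀ (by positivity)] at h1
    linarith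
  have h7 : p + (1 - τ)⁻¹ • v ∈ A := by
    refine hV _ (V.smul_mem _ hv) ?_
    rw [norm_smul, norm_inv, Real.norm_of_nonneg (by linarith), inv_mul_lt_iff₀ (by linarith)]
    nlinarith
  have h8 := hA h7 hq (by linarith : (0 : ℝ) ≤ 1 - τ) hτ (by ring)
  convert h8 using 1
  rw [smul_add, smul_smul, mul_inv_cancel₀ (by linarith), one_smul, hw, hu]
  module

theorem IsFullPolytope.convex {d : ℕ} {C : Set (E d)} (hC : IsFullPolytope C) : Convex ℝ C := by
  obtain ⟨⟨S, rfl⟩, -⟩ := hC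
  exact convex_convexHull ℝ _

theorem IsFullPolytope.isClosed {d : ℕ} {C : Set (E d)} (hC : IsFullPolytope C) : IsClosed C :=
  hC.isCompact.isClosed

theorem IsFullPolytope.closure_interior {d : ℕ} {C : Set (E d)} (hC : IsFullPolytope C) :
    closure (interior C) = C := by
  rw [hC.convex.closure_interior_eq_closure_of_nonempty_interior hC.2, hC.isClosed.closure_eq]

theorem IsFace.subset {d : ℕ} {C F : Set (E d)} (h : IsFace C F) : F ⊆ C := h.2.subset

theorem IsFace.convex {d : ℕ} {C F : Set (E d)} (h : IsFace C F) (hC : Convex ℝ C) : Convex ℝ F :=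
  h.2.convex hC

theorem IsFace.isClosed {d : ℕ} {C F : Set (E d)} (h : IsFace C F) (hC : IsFullPolytope C) :
    IsClosed F :=
  h.2.isClosed hC.isClosed

theorem IsFace.isCompact {d : ℕ} {C F : Set (E d)} (h : IsFace C F) (hC : IsFullPolytope C) :
    IsCompact F :=
  h.2.isCompact hC.isCompact

/-- By Krein–Milman a face is the closed convex hull of its extreme points, and these belong to the
finite generating set of the polytope. -/
theorem finite_setOf_isFace {d : ℕ} {C : Set (E d)} (hC : IsFullPolytope C) :
    {F | IsFace C F}.Finite := by
  have hcomp := hC.isCompact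
  have hconv := hC.convex
  obtain ⟨⟨S, hS⟩, -⟩ := hC
  have hfin : ((fun A : Set (E d) => closure (convexHull ℝ A)) '' (S : Set (E d)).powerset).Finite :=
    (S.finite_toSet.finite_subsets).image _
  refine hfin.subset fun F hF => ⟨F.extremePoints ℝ, ?_, ?_⟩
  · intro x hx
    have : x ∈ C.extremePoints ℝ := hF.2.isExtreme.extremePoints_subset_extremePoints hx
    rw [hS] at this
    exact extremePoints_convexHull_subset this
  · exact closure_convexHull_extremePoints (hF.2.isCompact hcomp) (hF.2.convex hconv)

/-- An exposed face of a face of a polytope is a face of the polytope. -/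
theorem IsFullPolytope.isExposed_trans {d : ℕ} {C F G : Set (E d)} (hC : IsFullPolytope C)
    (hF : IsExposed ℝ C F) (hG : IsExposed ℝ F G) : IsExposed ℝ C G := by
  rintro ⟨x, hx⟩
  obtain ⟨m, hm⟩ := hG ⟨x, hx⟩
  obtain ⟨l, hl⟩ := hF ⟨x, hG.subset hx⟩
  have hxF : x ∈ F := hG.subset hx
  have hxC : x ∈ C := hF.subset hxF
  have hlx : ∀ y ∈ C, l y ≤ l x := by rw [hl] at hxF; exact hxF.2
  have hmx : ∀ y ∈ F, m y ≤ m x := by rw [hm] at hx; exact hx.2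
  obtain ⟨⟨S, hS⟩, -⟩ := hC
  have hSC : ∀ v ∈ S, v ∈ C := fun v hv => hS ▸ subset_convexHull ℝ _ hv
  have hev : ∀ v ∈ S, ∀ᶠ N : ℝ in atTop, N * l v + m v ≤ N * l x + m x := by
    intro v hv
    rcases (hlx v (hSC v hv)).eq_or_lt with h | h
    · have hvF : v ∈ F := by rw [hl]; exact ⟨hSC v hv, fun y hy => h ▸ hlx y hy⟩
      exact Eventually.of_forall fun N => by rw [h]; linarith [hmx v hvF]
    · filter_upwards [eventually_ge_atTop ((m v - m x) / (l x - l v))] with N hN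
      rw [div_le_iff₀ (by linarith)] at hN
      linarith
  -- A vertex outside `F` has strictly smaller `l`, so a large multiple of `l` dominates `m` there;
  -- finitely many vertices allow one `N`.
  obtain ⟨N, hN⟩ := ((Finset.eventually_all S).2 hev).exists
  have hNC : ∀ y ∈ C, N * l y + m y ≤ N * l x + m x := by
    intro y hy
    have hsub : C ⊆ {y | (N • l + m) y ≤ N * l x + m x} := by
      rw [hS]
      refine convexHull_min (fun v hv => by simpa using hN v hv) ?_
      exact convex_halfSpace_le (N • l + m).toLinearMap.isLinear _
    simpa using hsub hy
  -- The extra copy of `l` beyond `N` forces every maximum point to maximize `l` as well, hence to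
  -- lie in `F`.
  refine ⟨(N + 1) • l + m, Set.Subset.antisymm ?_ ?_⟩
  · intro y hy
    have hyF := hG.subset hy
    have hyC := hF.subset hyF
    have h1 : l y = l x := le_antisymm (hlx y hyC) (by rw [hl] at hyF; exact hyF.2 x hxC)
    have h2 : m y = m x := le_antisymm (hmx y hyF) (by rw [hm] at hy; exact hy.2 x hxF)
    refine ⟨hyC, fun z hz => ?_⟩
    have h3 := hNC z hz
    have h4 := hlx z hz
    simp only [add_apply, smul_apply, smul_eq_mul, h1, h2]
    linarith
  · rintro y ⟨hyC, hy⟩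
    have h1 := hy x hxC
    simp only [add_apply, smul_apply, smul_eq_mul] at h1
    have h2 := hNC y hyC
    have h3 := hlx y hyC
    have h4 : l y = l x := by linarith
    have h5 : m y = m x := by rw [h4] at h1 h2; linarith
    have hyF : y ∈ F := by rw [hl]; exact ⟨hyC, fun z hz => h4 ▸ hlx z hz⟩
    rw [hm]
    exact ⟨hyF, fun z hz => h5 ▸ hmx z hz⟩

theorem IsFace.trans {d : ℕ} {C F G : Set (E d)} (hC : IsFullPolytope C)
    (hF : IsFace C F) (hG : IsFace F G) : IsFace C G :=
  ⟨hG.1, hC.isExposed_trans hF.2 hG.2⟩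

theorem IsFace.inter {d : ℕ} {C F G : Set (E d)} (hF : IsFace C F) (hG : IsFace C G)
    (h : (F ∩ G).Nonempty) : IsFace C (F ∩ G) :=
  ⟨h, hF.2.inter hG.2⟩

theorem IsFace.of_subset {d : ℕ} {C F G : Set (E d)} (hF : F ⊆ C) (hG : IsFace C G)
    (h : G ⊆ F) : IsFace F G :=
  ⟨hG.1, hG.2.mono hF h⟩

/-- A face is cut out by a linear functional that is constant on it, and strictly smaller on the
rest of the set. -/
theorem IsFace.exists_functional {d : ℕ} {K G : Set (E d)} (hG : IsFace K G) :
    ∃ l : StrongDual ℝ (E d), (∀ v ∈ vectorSpan ℝ G, l v = 0) ∧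
      (∀ g ∈ G, ∀ x ∈ K, l (x - g) ≤ 0) ∧ ∀ g ∈ G, ∀ x ∈ K, x ∉ G → l (x - g) < 0 := by
  obtain ⟨hne, hexp⟩ := hG
  have hsub := hexp.subset
  obtain ⟨l, hl⟩ := hexp hne
  have hle : ∀ g ∈ G, ∀ x ∈ K, l x ≤ l g := fun g hg x hx => by
    rw [hl] at hg; exact hg.2 x hx
  refine ⟨l, fun v hv => ?_, fun g hg x hx => ?_, fun g hg x hx hxG => ?_⟩
  · have : vectorSpan ℝ G ≤ LinearMap.ker l.toLinearMap := by
      rw [vectorSpan, Submodule.span_le]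
      rintro _ ⟨x, hx, y, hy, rfl⟩
      have := le_antisymm (hle y hy x (hsub hx)) (hle x hx y (hsub hy))
      simp [this]
    exact this hv
  · rw [map_sub]; linarith [hle g hg x hx]
  · rw [map_sub, sub_neg]
    by_contra hcon
    push Not at hcon
    exact hxG (by rw [hl]; exact ⟨hx, fun y hy => (hle g hg y hy).trans hcon⟩)

theorem IsFace.dim_lt {d : ℕ} {K G : Set (E d)} (hG : IsFace K G) (hne : G ≠ K) :
    dim G < dim K := by
  obtain ⟨l, hl0, -, hl1⟩ := hG.exists_functional
  obtain ⟨x, hx, hxG⟩ : ∃ x ∈ K, x ∉ G := by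
    by_contra! h
    exact hne (hG.subset.antisymm h)
  obtain ⟨g, hg⟩ := hG.1
  refine Submodule.finrank_lt_finrank_of_lt (lt_of_le_of_ne (vectorSpan_mono ℝ hG.subset) ?_)
  intro heq
  have h1 : x - g ∈ vectorSpan ℝ G := heq ▸ vsub_mem_vectorSpan ℝ hx (hG.subset hg)
  exact (hl1 g hg x hx hxG).ne (hl0 _ h1)

theorem IsFullPolytope.vectorSpan_eq {d : ℕ} {C : Set (E d)} (hC : IsFullPolytope C) :
    vectorSpan ℝ C = ⊤ := by
  obtain ⟨x, hx⟩ := hC.2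
  have h1 : affineSpan ℝ C = ⊤ := by
    refine top_le_iff.1 ?_
    rw [← isOpen_interior.affineSpan_eq_top hC.2]
    exact affineSpan_mono ℝ interior_subset
  rw [← direction_affineSpan, h1, AffineSubspace.direction_top]

theorem IsFullPolytope.dim_eq {d : ℕ} {C : Set (E d)} (hC : IsFullPolytope C) : dim C = d := by
  rw [dim, hC.vectorSpan_eq, finrank_top]
  simp

theorem IsFace.dim_lt_of_ne {d : ℕ} {C G : Set (E d)} (hC : IsFullPolytope C) (hG : IsFace C G)
    (hne : G ≠ C) : dim G + 1 ≤ d := by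
  have := hG.dim_lt hne
  rw [hC.dim_eq] at this
  exact this

theorem IsFacet.ne {d : ℕ} {C F : Set (E d)} (hC : IsFullPolytope C) (hF : IsFacet C F) :
    F ≠ C := by
  rintro rfl
  have := hF.2
  rw [hC.dim_eq] at this
  omega

theorem IsFace.notMem_interior {d : ℕ} {C F : Set (E d)} (hF : IsFace C F) (hne : F ≠ C) {x : E d}
    (hx : x ∈ F) : x ∉ interior C :=
  fun h => hne ((isRelInterior_of_mem_interior h).eq_of_isExposed hF.2 hx)

theorem exists_proper_face_of_notMem_interior {d : ℕ} {C : Set (E d)} (hC : IsFullPolytope C)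
    {x : E d} (hx : x ∈ C) (hxi : x ∉ interior C) : ∃ F, IsFace C F ∧ x ∈ F ∧ F ≠ C := by
  by_contra! h
  obtain ⟨r, hr, hb⟩ := isRelInterior_of_forall_isExposed hC.convex hx
    fun G hG hxG => h G ⟨⟨x, hxG⟩, hG⟩ hxG
  refine hxi (mem_interior.2 ⟨Metric.ball x r, fun y hy => ?_, Metric.isOpen_ball,
    Metric.mem_ball_self hr⟩)
  have := hb (y - x) (by rw [hC.vectorSpan_eq]; trivial)
    (by simpa [Metric.mem_ball, dist_eq_norm] using hy)
  simpa using this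

/-! ### Local structure of a tiling at a hyperface -/

theorem IsNormalTiling.eq_of_mem_interior {d : ℕ} {T : Set (Set (E d))} (hT : IsNormalTiling T)
    {C D : Set (E d)} (hC : C ∈ T) (hD : D ∈ T) {x : E d} (hx : x ∈ interior C) (hxD : x ∈ D) :
    C = D := by
  by_contra hne
  rw [← (hT.polytope D hD).closure_interior] at hxD
  obtain ⟨y, hy1, hy2⟩ := mem_closure_iff.1 hxD _ isOpen_interior hx
  exact Set.disjoint_left.1 (hT.disjoint_interior hC hD hne) hy1 hy2

theorem IsParallelohedralTiling.exists_vadd_eq {d : ℕ} {P : Set (E d)} {T : Set (Set (E d))}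
    (hT : IsParallelohedralTiling P T) {C D : Set (E d)} (hC : C ∈ T) (hD : D ∈ T) :
    ∃ t : E d, D = t +ᵥ C := by
  obtain ⟨t, rfl⟩ := hT.translates C hC
  obtain ⟨u, rfl⟩ := hT.translates D hD
  exact ⟨u - t, by rw [vadd_vadd, sub_add_cancel]⟩

/-- A packing argument: the interiors are disjoint, have volume bounded below by that of one fixed
cell, and all lie in a fixed ball. -/
theorem IsParallelohedralTiling.finite_inter_nonempty {d : ℕ} {P : Set (E d)}
    {T : Set (Set (E d))} (hT : IsParallelohedralTiling P T) {B : Set (E d)}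
    (hB : Bornology.IsBounded B) : {C | C ∈ T ∧ (C ∩ B).Nonempty}.Finite := by
  rcases T.eq_empty_or_nonempty with rfl | ⟨C₀, hC₀⟩
  · simp
  have hP := hT.tiling.polytope C₀ hC₀
  obtain ⟨R, hR⟩ := hP.isCompact.isBounded.subset_closedBall 0
  obtain ⟨R', hR'⟩ := hB.subset_closedBall 0
  set ι := {C // C ∈ T ∧ (C ∩ B).Nonempty}
  have htr : ∀ C : ι, ∃ t : E d, (C : Set (E d)) = t +ᵥ C₀ := fun C =>
    hT.exists_vadd_eq hC₀ C.2.1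
  have hvol : ∀ C : ι, MeasureTheory.volume (interior C₀) ≤
      MeasureTheory.volume (interior (C : Set (E d))) := by
    intro C
    obtain ⟨t, ht⟩ := htr C
    have : t +ᵥ interior C₀ ⊆ interior (C : Set (E d)) := by
      rw [ht]
      refine interior_maximal (Set.vadd_set_mono interior_subset) ?_
      exact isOpen_interior.vadd t
    exact (MeasureTheory.measure_vadd MeasureTheory.volume t (interior C₀)).symm.le.trans
      (MeasureTheory.measure_mono this)
  have hsub : (⋃ C : ι, interior (C : Set (E d))) ⊆ Metric.closedBall 0 (R' + 2 * R) := by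
    refine Set.iUnion_subset fun C x hx => ?_
    have hx := interior_subset hx
    obtain ⟨b, hbC, hbB⟩ := C.2.2
    obtain ⟨t, ht⟩ := htr C
    rw [ht] at hx hbC
    obtain ⟨x', hx', rfl⟩ := hx
    obtain ⟨b', hb', rfl⟩ := hbC
    have h1 := hR hx'
    have h2 := hR hb'
    have h3 := hR' hbB
    simp only [mem_closedBall_zero_iff, vadd_eq_add] at *
    have : t + x' = (t + b') + (x' - b') := by abel
    rw [this]
    linarith [norm_add_le (t + b') (x' - b'), norm_sub_le x' b']
  have hfin := MeasureTheory.Measure.finite_const_le_meas_of_disjoint_iUnion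
    (MeasureTheory.volume : MeasureTheory.Measure (E d))
    (isOpen_interior.measure_pos MeasureTheory.volume hP.2)
    (As := fun C : ι => interior (C : Set (E d))) (fun C => isOpen_interior.measurableSet)
    (fun C D hCD => hT.tiling.disjoint_interior C.2.1 D.2.1 (fun h => hCD (Subtype.ext h)))
    ((MeasureTheory.measure_mono hsub).trans_lt
      MeasureTheory.measure_closedBall_lt_top).ne
  have huniv : {C : ι | MeasureTheory.volume (interior C₀) ≤
      MeasureTheory.volume (interior (C : Set (E d)))} = Set.univ :=
    Set.eq_univ_of_forall hvol
  rw [huniv, Set.finite_univ_iff] at hfin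
  exact Set.finite_coe_iff.1 hfin

theorem IsParallelohedralTiling.isClosed_sUnion {d : ℕ} {P : Set (E d)} {T T' : Set (Set (E d))}
    (hT : IsParallelohedralTiling P T) (hT' : T' ⊆ T) : IsClosed (⋃₀ T') := by
  rw [Set.sUnion_eq_iUnion]
  refine LocallyFinite.isClosed_iUnion (fun x => ?_) fun C => (hT.tiling.polytope _ (hT' C.2)).isClosed
  refine ⟨Metric.ball x 1, Metric.ball_mem_nhds x one_pos, ?_⟩
  exact ((hT.finite_inter_nonempty Metric.isBounded_ball).preimage
    (f := Subtype.val) Subtype.val_injective.injOn).subset fun C hC => ⟨hT' C.2, hC⟩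

theorem IsParallelohedralTiling.countable {d : ℕ} {P : Set (E d)} {T : Set (Set (E d))}
    (hT : IsParallelohedralTiling P T) : T.Countable := by
  refine (Set.countable_iUnion fun n : ℕ =>
    (hT.finite_inter_nonempty (Metric.isBounded_closedBall (x := 0) (r := n))).countable).mono ?_
  intro C hC
  obtain ⟨x, hx⟩ := (hT.tiling.polytope C hC).2
  obtain ⟨n, hn⟩ := exists_nat_ge ‖x‖
  exact Set.mem_iUnion.2 ⟨n, hC, x, interior_subset hx, by simpa using hn⟩

/-- The faces of the cells of codimension at least `j`. -/
def lowFaces {d : ℕ} (T : Set (Set (E d))) (j : ℕ) : Set (Set (E d)) :=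
  {K | ∃ C ∈ T, IsFace C K ∧ dim K + j ≤ d}

/-- The union of the faces of the cells of codimension at least `j`. -/
def skel {d : ℕ} (T : Set (Set (E d))) (j : ℕ) : Set (E d) :=
  ⋃₀ lowFaces T j

theorem IsFace.mem_skel {d : ℕ} {T : Set (Set (E d))} {C K : Set (E d)} (hC : C ∈ T)
    (hK : IsFace C K) {j : ℕ} (hj : dim K + j ≤ d) {x : E d} (hx : x ∈ K) : x ∈ skel T j :=
  ⟨K, ⟨C, hC, hK, hj⟩, hx⟩

theorem lowFaces_mono {d : ℕ} (T : Set (Set (E d))) {i j : ℕ} (h : i ≤ j) :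
    lowFaces T j ⊆ lowFaces T i :=
  fun _ ⟨C, hC, hK, hj⟩ => ⟨C, hC, hK, by omega⟩

theorem facets_subset_lowFaces {d : ℕ} (T : Set (Set (E d))) : facets T ⊆ lowFaces T 1 :=
  fun _ ⟨C, hC, hF⟩ => ⟨C, hC, hF.1, hF.2.le⟩

theorem IsParallelohedralTiling.countable_lowFaces {d : ℕ} {P : Set (E d)} {T : Set (Set (E d))}
    (hT : IsParallelohedralTiling P T) (j : ℕ) : (lowFaces T j).Countable := by
  refine (hT.countable.biUnion (t := fun C _ => {F | IsFace C F}) fun C hC =>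
    (finite_setOf_isFace (hT.tiling.polytope C hC)).countable).mono ?_
  rintro K ⟨C, hC, hK, -⟩
  exact Set.mem_biUnion hC hK

theorem IsParallelohedralTiling.finite_facets_inter_nonempty {d : ℕ} {P : Set (E d)}
    {T : Set (Set (E d))} (hT : IsParallelohedralTiling P T) {B : Set (E d)}
    (hB : Bornology.IsBounded B) : {F | F ∈ facets T ∧ (F ∩ B).Nonempty}.Finite := by
  refine ((hT.finite_inter_nonempty hB).biUnion (t := fun C => {F | IsFace C F}) fun C hC =>
    (finite_setOf_isFace (hT.tiling.polytope C hC.1))).subset ?_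
  rintro F ⟨⟨C, hC, hF⟩, hne⟩
  exact Set.mem_biUnion ⟨hC, hne.mono (Set.inter_subset_inter_left _ hF.1.subset)⟩ hF.1

/-- The source of all general position arguments: countably many proper affine subspaces have
measure zero, a nonempty open set does not. -/
theorem exists_mem_open_forall_notMem {d : ℕ} {U : Set (E d)} (hU : IsOpen U) (hne : U.Nonempty)
    {ι : Type*} {s : Set ι} (hs : s.Countable) (A : ι → AffineSubspace ℝ (E d))
    (hA : ∀ i ∈ s, A i ≠ ⊤) : ∃ x ∈ U, ∀ i ∈ s, x ∉ A i := by
  have h0 : MeasureTheory.volume (⋃ i ∈ s, (A i : Set (E d))) = 0 :=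
    (MeasureTheory.measure_biUnion_null_iff hs).2 fun i hi =>
      MeasureTheory.Measure.addHaar_affineSubspace _ _ (hA i hi)
  have hpos := hU.measure_pos MeasureTheory.volume hne
  have hnot : ¬ U ⊆ ⋃ i ∈ s, (A i : Set (E d)) := fun h =>
    hpos.ne' (MeasureTheory.measure_mono_null h h0)
  obtain ⟨x, hxU, hx⟩ := Set.not_subset.1 hnot
  refine ⟨x, hxU, fun i hi hxi => hx (Set.mem_biUnion hi hxi)⟩

theorem affineSpan_ne_top_of_finrank_lt {d : ℕ} {S : Set (E d)}
    (h : Module.finrank ℝ (vectorSpan ℝ S) < d) : affineSpan ℝ S ≠ ⊤ := by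
  intro htop
  rw [← direction_affineSpan, htop, AffineSubspace.direction_top, finrank_top,
    finrank_euclideanSpace_fin] at h
  exact lt_irrefl _ h

theorem IsNormalTiling.ne_of_mem_lowFaces {d : ℕ} {T : Set (Set (E d))} (hT : IsNormalTiling T)
    {C K : Set (E d)} (hC : C ∈ T) {j : ℕ} (hK : dim K + (j + 1) ≤ d) : K ≠ C := by
  rintro rfl
  rw [(hT.polytope _ hC).dim_eq] at hK
  omega

theorem IsNormalTiling.notMem_of_mem_interior {d : ℕ} {T : Set (Set (E d))}
    (hT : IsNormalTiling T) {C K : Set (E d)} (hC : C ∈ T) {x : E d} (hx : x ∈ interior C)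
    {j : ℕ} (hK : K ∈ lowFaces T (j + 1)) : x ∉ K := by
  obtain ⟨D, hD, hK, hj⟩ := hK
  intro hxK
  obtain rfl := hT.eq_of_mem_interior hC hD hx (hK.subset hxK)
  exact hK.notMem_interior (hT.ne_of_mem_lowFaces hC hj) hxK hx

/-- Otherwise `p` lies in a proper face of `K`, whose dimension is at least one less, and this face
is part of `skel T j`. The drop in dimension explains the bound `d + 1`. -/
theorem IsNormalTiling.isRelInterior {d : ℕ} {T : Set (Set (E d))} (hT : IsNormalTiling T)
    {C K : Set (E d)} (hC : C ∈ T) (hK : IsFace C K) {j : ℕ} (hj : dim K + j ≤ d + 1) {p : E d}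
    (hp : p ∈ K) (hps : p ∉ skel T j) : IsRelInterior K p := by
  have hCp := hT.polytope C hC
  refine isRelInterior_of_forall_isExposed (hK.convex hCp.convex) hp fun G hG hpG => ?_
  by_contra hne
  have hG' : IsFace K G := ⟨⟨p, hpG⟩, hG⟩
  have := hG'.dim_lt hne
  exact hps ((hK.trans hCp hG').mem_skel hC (by omega) hpG)

theorem IsFacet.eq_of_mem {d : ℕ} {T : Set (Set (E d))}
    {C F G : Set (E d)} (hF : IsFacet C F) (hG : IsFacet C G) (hC : C ∈ T) {p : E d}
    (hpF : p ∈ F) (hpG : p ∈ G) (hp : p ∉ skel T 2) : F = G := by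
  have key : ∀ {F G : Set (E d)}, IsFacet C F → IsFacet C G → p ∈ F → p ∈ G → F ∩ G = F := by
    intro F G hF hG hpF hpG
    have hface := hF.1.inter hG.1 ⟨p, hpF, hpG⟩
    by_contra hne
    have := (IsFace.of_subset hF.1.subset hface Set.inter_subset_left).dim_lt hne
    have := hF.2
    exact hp (hface.mem_skel hC (by omega) ⟨hpF, hpG⟩)
  rw [← key hF hG hpF hpG, Set.inter_comm, key hG hF hpG hpF]

theorem IsNormalTiling.inter_isFace {d : ℕ} {T : Set (Set (E d))} (hT : IsNormalTiling T)
    {C D : Set (E d)} (hC : C ∈ T) (hD : D ∈ T) (hne : C ≠ D) {x : E d} (hxC : x ∈ C)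
    (hxD : x ∈ D) : IsFace C (C ∩ D) ∧ IsFace D (C ∩ D) :=
  (hT.face_to_face hC hD hne).resolve_left fun h => by
    have : x ∈ C ∩ D := ⟨hxC, hxD⟩
    rw [h] at this
    exact this

theorem IsNormalTiling.inter_ne {d : ℕ} {T : Set (Set (E d))} (hT : IsNormalTiling T)
    {C D : Set (E d)} (hC : C ∈ T) (hD : D ∈ T) (hne : C ≠ D) : C ∩ D ≠ C := by
  intro h
  obtain ⟨x, hx⟩ := (hT.polytope C hC).2
  have h2 := interior_subset hx
  rw [← h] at h2
  exact hne (hT.eq_of_mem_interior hC hD hx h2.2)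

/-- The union of the other cells is closed, so it contains the boundary point `z` and some `D` does.
As `z` avoids codimension two, the proper face `C ∩ D` has codimension exactly one, and two facets
of `C` through such a point coincide. -/
theorem IsParallelohedralTiling.exists_adjacent {d : ℕ} {P : Set (E d)} {T : Set (Set (E d))}
    (hT : IsParallelohedralTiling P T) {C F : Set (E d)} (hC : C ∈ T) (hF : IsFacet C F) {z : E d}
    (hz : z ∈ F) (hzs : z ∉ skel T 2) : ∃ D ∈ T, C ≠ D ∧ C ∩ D = F ∧ Adjacent C D := by
  have hN := hT.tiling
  have hCp := hN.polytope C hC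
  have hzi : z ∉ interior C := hF.1.notMem_interior (hF.ne hCp) hz
  have hzcl : z ∈ ⋃₀ (T \ {C}) := by
    have h1 : z ∈ closure Cᶜ := by rwa [closure_compl, Set.mem_compl_iff]
    refine closure_minimal ?_ (hT.isClosed_sUnion Set.sdiff_subset) h1
    intro y hy
    obtain ⟨D, hD, hyD⟩ : y ∈ ⋃₀ T := by rw [hN.cover]; trivial
    exact ⟨D, ⟨hD, fun h => hy (h ▸ hyD)⟩, hyD⟩
  obtain ⟨D, ⟨hD, hne⟩, hzD⟩ := hzcl
  have hne' : C ≠ D := fun h => hne h.symm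
  obtain ⟨h1, h2⟩ := hN.inter_isFace hC hD hne' (hF.1.subset hz) hzD
  have hlt := h1.dim_lt_of_ne hCp (hN.inter_ne hC hD hne')
  have hdim : dim (C ∩ D) + 1 = d := by
    by_contra h
    exact hzs (h1.mem_skel hC (by omega) ⟨hF.1.subset hz, hzD⟩)
  exact ⟨D, hD, hne', (hF.eq_of_mem ⟨h1, hdim⟩ hC hz ⟨hF.1.subset hz, hzD⟩ hzs).symm,
    ⟨h1, hdim⟩, ⟨h2, hdim⟩⟩

theorem IsParallelohedralTiling.exists_facet {d : ℕ} {P : Set (E d)} {T : Set (Set (E d))}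
    (hT : IsParallelohedralTiling P T) {C : Set (E d)} (hC : C ∈ T) {z : E d}
    (hz : z ∈ C) (hzi : z ∉ interior C) (hzs : z ∉ skel T 2) : ∃ F, IsFacet C F ∧ z ∈ F := by
  have hCp := hT.tiling.polytope C hC
  obtain ⟨F, hF, hzF, hne⟩ := exists_proper_face_of_notMem_interior hCp hz hzi
  have hlt := hF.dim_lt_of_ne hCp hne
  refine ⟨F, ⟨hF, ?_⟩, hzF⟩
  by_contra h
  exact hzs (hF.mem_skel hC (by omega) hzF)

/-- `n` is the unit outer normal of the convex set `C` along its hyperface `F`. -/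
structure IsOuterNormal {d : ℕ} (C F : Set (E d)) (n : E d) : Prop where
  norm : ‖n‖ = 1
  mem_iff : ∀ v, v ∈ vectorSpan ℝ F ↔ ⟪n, v⟫_ℝ = 0
  nonpos : ∀ z ∈ F, ∀ y ∈ C, ⟪n, y - z⟫_ℝ ≤ 0
  mem_of_eq : ∀ z ∈ F, ∀ y ∈ C, ⟪n, y - z⟫_ℝ = 0 → y ∈ F

theorem IsOuterNormal.inner_self {d : ℕ} {C F : Set (E d)} {n : E d} (hn : IsOuterNormal C F n) :
    ⟪n, n⟫_ℝ = 1 := by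
  rw [real_inner_self_eq_norm_sq, hn.norm, one_pow]

theorem IsFacet.exists_isOuterNormal {d : ℕ} {C F : Set (E d)} (hC : IsFullPolytope C)
    (hF : IsFacet C F) : ∃ n, IsOuterNormal C F n := by
  obtain ⟨l, h0, h1, h2⟩ := hF.1.exists_functional
  obtain ⟨x, hx, hxF⟩ : ∃ x ∈ C, x ∉ F := by
    by_contra! h
    exact hF.ne hC (hF.1.subset.antisymm h)
  obtain ⟨g, hg⟩ := hF.1.1
  have hlx := h2 g hg x hx hxF
  set w : E d := (InnerProductSpace.toDual ℝ (E d)).symm l with hw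
  have hin : ∀ v, ⟪w, v⟫_ℝ = l v := fun v => InnerProductSpace.toDual_symm_apply
  have hw0 : w ≠ 0 := by
    intro h
    rw [← hin, h, inner_zero_left] at hlx
    exact lt_irrefl _ hlx
  have hwn : 0 < ‖w‖ := norm_pos_iff.2 hw0
  have hker : vectorSpan ℝ F = LinearMap.ker l.toLinearMap := by
    refine Submodule.eq_of_le_of_finrank_le (fun v hv => h0 v hv) ?_
    have hne : LinearMap.ker l.toLinearMap ≠ ⊤ := by
      intro h
      have : x - g ∈ LinearMap.ker l.toLinearMap := h ▸ Submodule.mem_top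
      exact hlx.ne this
    have h3 := Submodule.finrank_lt hne
    rw [finrank_euclideanSpace_fin] at h3
    have h4 := hF.2
    rw [dim] at h4
    omega
  have hinn : ∀ v, ⟪‖w‖⁻¹ • w, v⟫_ℝ = ‖w‖⁻¹ * l v := fun v => by
    rw [real_inner_smul_left, hin]
  refine ⟨‖w‖⁻¹ • w, ?_, fun v => ?_, fun z hz y hy => ?_, fun z hz y hy h => ?_⟩
  · rw [norm_smul, norm_inv, norm_norm, inv_mul_cancel₀ hwn.ne']
  · rw [hinn, hker, LinearMap.mem_ker]
    simp [hw0]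
  · rw [hinn]
    exact mul_nonpos_of_nonneg_of_nonpos (by positivity) (h1 z hz y hy)
  · by_contra hyF
    rw [hinn] at h
    have := h2 z hz y hy hyF
    have := mul_neg_of_pos_of_neg (inv_pos.2 hwn) this
    linarith

theorem IsOuterNormal.isUnitNormal {d : ℕ} {C F : Set (E d)} {n : E d} (hn : IsOuterNormal C F n) :
    IsUnitNormal F n :=
  ⟨hn.norm, fun w hw => (hn.mem_iff w).1 hw⟩

theorem IsOuterNormal.eq_or_eq_neg {d : ℕ} {C F : Set (E d)} {n m : E d}
    (hn : IsOuterNormal C F n) (hm : IsUnitNormal F m) : m = n ∨ m = -n := by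
  set c := ⟪n, m⟫_ℝ with hc
  have h1 : m - c • n ∈ vectorSpan ℝ F := by
    rw [hn.mem_iff, inner_sub_right, real_inner_smul_right, hn.inner_self, mul_one, sub_self]
  have h2 : m = c • n := by
    rw [← sub_eq_zero, ← inner_self_eq_zero (𝕜 := ℝ)]
    nth_rewrite 1 [inner_sub_left]
    rw [hm.2 _ h1, real_inner_smul_left, (hn.mem_iff _).1 h1]
    simp
  have h3 : |c| = 1 := by
    have := hm.1
    rw [h2, norm_smul, hn.norm, mul_one, Real.norm_eq_abs] at this
    exact this
  rcases eq_or_eq_neg_of_abs_eq h3 with h | h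
  · left; rw [h2, h, one_smul]
  · right; rw [h2, h, neg_smul, one_smul]

/-- Near a relative interior point of a facet the cell is a half-space: the cone over the hyperplane
of `F` and the direction of a point of `C` outside `F` is the whole closed half-space. -/
theorem IsOuterNormal.exists_ball {d : ℕ} {C F : Set (E d)} {n : E d} (hn : IsOuterNormal C F n)
    (hC : IsFullPolytope C) (hF : IsFacet C F) {z : E d} (hz : IsRelInterior F z) :
    ∃ r > 0, ∀ y, ‖y - z‖ < r → ⟪n, y - z⟫_ℝ ≤ 0 → y ∈ C := by
  obtain ⟨q, hq, hqF⟩ : ∃ x ∈ C, x ∉ F := by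
    by_contra! h
    exact hF.ne hC (hF.1.subset.antisymm h)
  have hzF := hz.mem
  obtain ⟨r, hr, hz⟩ := hz
  have hneg : ⟪n, q - z⟫_ℝ < 0 :=
    lt_of_le_of_ne (hn.nonpos z hzF q hq) fun h => hqF (hn.mem_of_eq z hzF q hq h)
  obtain ⟨r', hr', h⟩ := exists_half_ball_subset hC.convex hr
    (fun v hv hvr => hF.1.subset (hz v hv hvr)) hq (innerSL ℝ n)
    (fun v hv => by simpa using (hn.mem_iff v).1 hv) (by simpa using hneg.ne)
  refine ⟨r', hr', fun y hy hny => ?_⟩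
  set τ := ⟪n, y - z⟫_ℝ / ⟪n, q - z⟫_ℝ with hτ
  have hv : y - z - τ • (q - z) ∈ vectorSpan ℝ F := by
    rw [hn.mem_iff, inner_sub_right, real_inner_smul_right, hτ, div_mul_cancel₀ _ hneg.ne,
      sub_self]
  have := h _ hv τ (div_nonneg_of_nonpos hny hneg.le) (by simpa using hy)
  simpa using this

theorem IsOuterNormal.exists_ball_interior {d : ℕ} {C F : Set (E d)} {n : E d}
    (hn : IsOuterNormal C F n) (hC : IsFullPolytope C) (hF : IsFacet C F) {z : E d}
    (hz : IsRelInterior F z) :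
    ∃ r > 0, ∀ y, ‖y - z‖ < r → ⟪n, y - z⟫_ℝ < 0 → y ∈ interior C := by
  obtain ⟨r, hr, h⟩ := hn.exists_ball hC hF hz
  refine ⟨r, hr, fun y hy hny => mem_interior.2
    ⟨{y | ‖y - z‖ < r} ∩ {y | ⟪n, y - z⟫_ℝ < 0}, fun x hx => h x hx.1 (le_of_lt hx.2), ?_, hy, hny⟩⟩
  exact (isOpen_lt (by fun_prop) continuous_const).inter (isOpen_lt (by fun_prop) continuous_const)

theorem Adjacent.symm {d : ℕ} {C D : Set (E d)} (h : Adjacent C D) : Adjacent D C := by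
  unfold Adjacent at *
  rw [Set.inter_comm D C]
  exact ⟨h.2, h.1⟩

theorem Adjacent.ne {d : ℕ} {C D : Set (E d)} (hC : IsFullPolytope C) (h : Adjacent C D) :
    C ≠ D := by
  rintro rfl
  exact h.1.ne hC (Set.inter_self C)

/-- If both cells had the same outer normal, they would fill the same half-ball at a relative
interior point of the facet, and their interiors would meet. -/
theorem IsNormalTiling.isOuterNormal_neg {d : ℕ} {T : Set (Set (E d))} (hT : IsNormalTiling T)
    {C D : Set (E d)} (hC : C ∈ T) (hD : D ∈ T) (hadj : Adjacent C D) {n : E d}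
    (hn : IsOuterNormal C (C ∩ D) n) : IsOuterNormal D (C ∩ D) (-n) := by
  have hCp := hT.polytope C hC
  have hDp := hT.polytope D hD
  obtain ⟨m, hm⟩ := hadj.2.exists_isOuterNormal hDp
  rcases hn.eq_or_eq_neg hm.isUnitNormal with rfl | rfl
  · exfalso
    obtain ⟨z, hz⟩ := exists_isRelInterior (hadj.1.1.convex hCp.convex) hadj.1.1.1
    obtain ⟨r, hr, h1⟩ := hn.exists_ball_interior hCp hadj.1 hz
    obtain ⟨r', hr', h2⟩ := hm.exists_ball_interior hDp hadj.2 hz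
    obtain ⟨ε, hε, hεr⟩ := exists_between (lt_min hr hr')
    have h3 : ‖(z - ε • m) - z‖ = ε := by
      rw [sub_sub_cancel_left, norm_neg, norm_smul, hm.norm, mul_one, Real.norm_of_nonneg hε.le]
    have h4 : ⟪m, (z - ε • m) - z⟫_ℝ < 0 := by
      rw [sub_sub_cancel_left, inner_neg_right, real_inner_smul_right, hm.inner_self]
      linarith
    exact Set.disjoint_left.1 (hT.disjoint_interior hC hD (hadj.ne hCp))
      (h1 _ (by rw [h3]; exact hεr.trans_le (min_le_left _ _)) h4)
      (h2 _ (by rw [h3]; exact hεr.trans_le (min_le_right _ _)) h4)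
  · exact hm

theorem IsUnitNormalFromTo.isOuterNormal {d : ℕ} {C D : Set (E d)} (hC : IsFullPolytope C)
    (hadj : Adjacent C D) {n : E d} (hn : IsUnitNormalFromTo C D n) :
    IsOuterNormal C (C ∩ D) n := by
  obtain ⟨m, hm⟩ := hadj.1.exists_isOuterNormal hC
  rcases hm.eq_or_eq_neg hn.1 with rfl | rfl
  · exact hm
  · exfalso
    obtain ⟨z, hz⟩ := hadj.1.1.1
    refine hadj.1.ne hC (hadj.1.1.subset.antisymm fun y hy => hm.mem_of_eq z hz y hy ?_)
    have h1 := hm.nonpos z hz y hy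
    have h2 := (hn.2 z hz).1 y hy
    rw [inner_neg_left] at h2
    linarith

/-- The two cells adjacent along a hyperface fill a neighbourhood of each relative interior point
of the hyperface. -/
theorem IsNormalTiling.exists_ball_of_adjacent {d : ℕ} {T : Set (Set (E d))}
    (hT : IsNormalTiling T) {C D : Set (E d)} (hC : C ∈ T) (hD : D ∈ T) (hadj : Adjacent C D)
    {n : E d} (hn : IsOuterNormal C (C ∩ D) n) {z : E d} (hz : IsRelInterior (C ∩ D) z) :
    ∃ r > 0, ∀ y, ‖y - z‖ < r → (⟪n, y - z⟫_ℝ < 0 → y ∈ interior C) ∧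
      (0 < ⟪n, y - z⟫_ℝ → y ∈ interior D) ∧ (⟪n, y - z⟫_ℝ = 0 → y ∈ C ∩ D) := by
  obtain ⟨r₁, hr₁, h₁⟩ := hn.exists_ball_interior (hT.polytope C hC) hadj.1 hz
  obtain ⟨r₂, hr₂, h₂⟩ :=
    (hT.isOuterNormal_neg hC hD hadj hn).exists_ball_interior (hT.polytope D hD) hadj.2 hz
  obtain ⟨r₃, hr₃, h₃⟩ := hz
  refine ⟨min r₁ (min r₂ r₃), by positivity, fun y hy => ?_⟩
  obtain ⟨hy1, hy⟩ := lt_min_iff.1 hy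
  obtain ⟨hy2, hy3⟩ := lt_min_iff.1 hy
  refine ⟨h₁ y hy1, fun h => h₂ y hy2 (by rwa [inner_neg_left, neg_lt_zero]), fun h => ?_⟩
  have := h₃ (y - z) ((hn.mem_iff _).2 h) hy3
  simpa using this

/-- `x` is in general position with respect to `a` and the faces of codimension at least two. -/
def IsGenericFrom {d : ℕ} (T : Set (Set (E d))) (a x : E d) : Prop :=
  ∀ K ∈ lowFaces T 2, x ∉ affineSpan ℝ (insert a K)

theorem affineSpan_insert_ne_top {d : ℕ} {T : Set (Set (E d))} {K : Set (E d)}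
    (hK : K ∈ lowFaces T 2) (a : E d) : affineSpan ℝ (insert a K) ≠ ⊤ := by
  obtain ⟨C, hC, -, h⟩ := hK
  refine affineSpan_ne_top_of_finrank_lt ?_
  have := finrank_vectorSpan_insert_le_set ℝ K a
  rw [dim] at h
  omega

theorem IsParallelohedralTiling.exists_isGenericFrom {d : ℕ} {P : Set (E d)}
    {T : Set (Set (E d))} (hT : IsParallelohedralTiling P T) (a : E d) {U : Set (E d)}
    (hU : IsOpen U) (hne : U.Nonempty) : ∃ x ∈ U, IsGenericFrom T a x :=
  exists_mem_open_forall_notMem hU hne (hT.countable_lowFaces 2) _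
    fun _ hK => affineSpan_insert_ne_top hK a

/-- The forbidden affine hulls all contain `a`, so they contain a point other than `a` of a line
through `a` only together with the whole line. -/
theorem IsGenericFrom.lineMap {d : ℕ} {T : Set (Set (E d))} {a x : E d} (h : IsGenericFrom T a x)
    {t : ℝ} (ht : t ≠ 0) : IsGenericFrom T a (a + t • (x - a)) := by
  intro K hK hmem
  refine h K hK ?_
  have ha : a ∈ affineSpan ℝ (insert a K) := subset_affineSpan ℝ _ (Set.mem_insert _ _)
  have h1 := AffineMap.lineMap_mem t⁻¹ ha hmem
  rwa [AffineMap.lineMap_apply, vsub_eq_sub, vadd_eq_add, add_sub_cancel_left, smul_smul,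
    inv_mul_cancel₀ ht, one_smul, sub_add_cancel] at h1

theorem IsGenericFrom.notMem_skel {d : ℕ} {T : Set (Set (E d))} {a x : E d}
    (h : IsGenericFrom T a x) : x ∉ skel T 2 := by
  rintro ⟨K, hK, hx⟩
  exact h K hK (subset_affineSpan ℝ _ (Set.mem_insert_of_mem _ hx))

theorem mem_segment_iff_exists_add_smul {d : ℕ} {a x y : E d} :
    y ∈ segment ℝ a x ↔ ∃ t : ℝ, 0 ≤ t ∧ t ≤ 1 ∧ y = a + t • (x - a) := by
  rw [segment_eq_image']
  constructor
  · rintro ⟨t, ht, rfl⟩; exact ⟨t, ht.1, ht.2, rfl⟩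
  · rintro ⟨t, h0, h1, rfl⟩; exact ⟨t, ⟨h0, h1⟩, rfl⟩

theorem IsGenericFrom.notMem_skel_of_mem_segment {d : ℕ} {T : Set (Set (E d))} {a x y : E d}
    (h : IsGenericFrom T a x) (ha : a ∉ skel T 2) (hy : y ∈ segment ℝ a x) : y ∉ skel T 2 := by
  obtain ⟨t, -, -, rfl⟩ := mem_segment_iff_exists_add_smul.1 hy
  rcases eq_or_ne t 0 with rfl | ht
  · simpa using ha
  · exact (h.lineMap ht).notMem_skel

theorem IsNormalTiling.notMem_skel_of_mem_interior {d : ℕ} {T : Set (Set (E d))}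
    (hT : IsNormalTiling T) {C : Set (E d)} (hC : C ∈ T) {x : E d} (hx : x ∈ interior C) :
    x ∉ skel T 2 := by
  rintro ⟨K, hK, hxK⟩
  exact hT.notMem_of_mem_interior hC hx (j := 1) hK hxK

/-- Any two cells are joined by a chain of adjacent cells. -/
theorem IsParallelohedralTiling.reflTransGen_adjacent {d : ℕ} {P : Set (E d)}
    {T : Set (Set (E d))} (hT : IsParallelohedralTiling P T) {C D : Set (E d)} (hC : C ∈ T)
    (hD : D ∈ T) :
    Relation.ReflTransGen (fun A B => A ∈ T ∧ B ∈ T ∧ Adjacent A B) C D := by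
  have hN := hT.tiling
  set R : Set (E d) → Set (E d) → Prop := fun A B => A ∈ T ∧ B ∈ T ∧ Adjacent A B with hR
  set K : Set (Set (E d)) := {B | B ∈ T ∧ Relation.ReflTransGen R C B} with hK
  have hKT : K ⊆ T := fun B hB => hB.1
  obtain ⟨a, ha⟩ := (hN.polytope C hC).2
  obtain ⟨y, hy, hgen⟩ := hT.exists_isGenericFrom a isOpen_interior (hN.polytope D hD).2
  have hask := hN.notMem_skel_of_mem_interior hC ha
  -- Along the generic segment, the union of the cells reachable from `C` is open: a boundary point
  -- lies in a facet, off codimension two, and the cell across that facet is reachable too.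
  have hnhds : ∀ x ∈ segment ℝ a y, x ∈ ⋃₀ K → x ∈ interior (⋃₀ K) := by
    rintro x hx ⟨B, hB, hxB⟩
    by_cases hxi : x ∈ interior B
    · exact interior_mono (Set.subset_sUnion_of_mem hB) hxi
    have hxs := hgen.notMem_skel_of_mem_segment hask hx
    obtain ⟨F, hF, hxF⟩ := hT.exists_facet hB.1 hxB hxi hxs
    obtain ⟨B', hB', -, rfl, hadj⟩ := hT.exists_adjacent hB.1 hF hxF hxs
    have hB'K : B' ∈ K := ⟨hB', hB.2.tail ⟨hB.1, hB', hadj⟩⟩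
    obtain ⟨n, hn⟩ := hF.exists_isOuterNormal (hN.polytope B hB.1)
    obtain ⟨r, hr, h⟩ := hN.exists_ball_of_adjacent hB.1 hB' hadj hn
      (hN.isRelInterior hB.1 hF.1 (by have := hF.2; omega) hxF hxs)
    refine mem_interior.2 ⟨Metric.ball x r, fun z hz => ?_, Metric.isOpen_ball,
      Metric.mem_ball_self hr⟩
    obtain ⟨h1, h2, h3⟩ := h z (by simpa [Metric.mem_ball, dist_eq_norm] using hz)
    rcases lt_trichotomy ⟪n, z - x⟫_ℝ 0 with h0 | h0 | h0
    · exact ⟨B, hB, interior_subset (h1 h0)⟩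
    · exact ⟨B, hB, (h3 h0).1⟩
    · exact ⟨B', hB'K, interior_subset (h2 h0)⟩
  have hCK : C ∈ K := ⟨hC, Relation.ReflTransGen.refl⟩
  have hsub : segment ℝ a y ⊆ interior (⋃₀ K) := by
    refine (convex_segment a y).isPreconnected.subset_of_closure_inter_subset isOpen_interior
      ⟨a, left_mem_segment ℝ a y, interior_mono (Set.subset_sUnion_of_mem hCK) ha⟩ ?_
    rintro x ⟨hx, hxs⟩
    exact hnhds x hxs (closure_minimal interior_subset (hT.isClosed_sUnion hKT) hx)
  obtain ⟨B, hB, hyB⟩ := interior_subset (hsub (right_mem_segment ℝ a y))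
  obtain rfl := hN.eq_of_mem_interior hD hB.1 hy hyB
  exact hB.2

/-! ### Hyperfaces crossed by the segments issuing from a point -/

/-- `n` is the unit normal to `F` that points away from `a`. -/
structure IsNormalAwayFrom {d : ℕ} (a : E d) (F : Set (E d)) (n : E d) : Prop where
  norm : ‖n‖ = 1
  mem_iff : ∀ v, v ∈ vectorSpan ℝ F ↔ ⟪n, v⟫_ℝ = 0
  pos : ∀ z ∈ F, 0 < ⟪n, z - a⟫_ℝ

theorem IsOuterNormal.inner_sub_ne_zero {d : ℕ} {C F : Set (E d)} {n a z : E d}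
    (hn : IsOuterNormal C F n) (ha : a ∉ affineSpan ℝ F) (hz : z ∈ F) : ⟪n, z - a⟫_ℝ ≠ 0 := by
  intro h
  refine ha ?_
  have h1 : -(z - a) ∈ (affineSpan ℝ F).direction := by
    rw [direction_affineSpan]
    exact neg_mem ((hn.mem_iff _).2 h)
  have := AffineSubspace.vadd_mem_of_mem_direction h1 (subset_affineSpan ℝ F hz)
  simpa using this

theorem IsOuterNormal.inner_sub_eq {d : ℕ} {C F : Set (E d)} {n a y z : E d}
    (hn : IsOuterNormal C F n) (hy : y ∈ F) (hz : z ∈ F) : ⟪n, y - a⟫_ℝ = ⟪n, z - a⟫_ℝ := by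
  have := (hn.mem_iff _).1 (vsub_mem_vectorSpan ℝ hy hz)
  rw [vsub_eq_sub] at this
  rw [← sub_eq_zero, ← inner_sub_right, sub_sub_sub_cancel_right, this]

theorem IsOuterNormal.isNormalAwayFrom {d : ℕ} {C F : Set (E d)} {n a z : E d}
    (hn : IsOuterNormal C F n) (hz : z ∈ F) (h : 0 < ⟪n, z - a⟫_ℝ) : IsNormalAwayFrom a F n :=
  ⟨hn.norm, hn.mem_iff, fun y hy => by rwa [hn.inner_sub_eq hy hz]⟩

theorem IsOuterNormal.isNormalAwayFrom_neg {d : ℕ} {C F : Set (E d)} {n a z : E d}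
    (hn : IsOuterNormal C F n) (hz : z ∈ F) (h : ⟪n, z - a⟫_ℝ < 0) : IsNormalAwayFrom a F (-n) :=
  ⟨by rw [norm_neg, hn.norm], fun v => by rw [hn.mem_iff, inner_neg_left, neg_eq_zero],
    fun y hy => by rwa [inner_neg_left, hn.inner_sub_eq hy hz, neg_pos]⟩

theorem IsNormalTiling.exists_isNormalAwayFrom {d : ℕ} {T : Set (Set (E d))}
    (hT : IsNormalTiling T) {F : Set (E d)} (hF : F ∈ facets T) {a : E d}
    (ha : a ∉ affineSpan ℝ F) : ∃ n, IsNormalAwayFrom a F n := by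
  obtain ⟨C, hC, hF⟩ := hF
  obtain ⟨n, hn⟩ := hF.exists_isOuterNormal (hT.polytope C hC)
  obtain ⟨z, hz⟩ := hF.1.1
  rcases (hn.inner_sub_ne_zero ha hz).lt_or_gt with h | h
  · exact ⟨-n, hn.isNormalAwayFrom_neg hz h⟩
  · exact ⟨n, hn.isNormalAwayFrom hz h⟩

theorem IsNormalAwayFrom.inner_self {d : ℕ} {F : Set (E d)} {a n : E d}
    (hn : IsNormalAwayFrom a F n) : ⟪n, n⟫_ℝ = 1 := by
  rw [real_inner_self_eq_norm_sq, hn.norm, one_pow]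

theorem IsNormalAwayFrom.inner_sub_eq_zero {d : ℕ} {F : Set (E d)} {a n y z : E d}
    (hn : IsNormalAwayFrom a F n) (hy : y ∈ F) (hz : z ∈ F) : ⟪n, y - z⟫_ℝ = 0 :=
  (hn.mem_iff _).1 (vsub_mem_vectorSpan ℝ hy hz)

theorem IsNormalAwayFrom.unique {d : ℕ} {F : Set (E d)} {a n m : E d}
    (hn : IsNormalAwayFrom a F n) (hm : IsNormalAwayFrom a F m) (hF : F.Nonempty) : n = m := by
  obtain ⟨z, hz⟩ := hF
  set c := ⟪n, m⟫_ℝ with hc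
  have h1 : m - c • n ∈ vectorSpan ℝ F := by
    rw [hn.mem_iff, inner_sub_right, real_inner_smul_right, hn.inner_self, mul_one, sub_self]
  have h2 : m = c • n := by
    rw [← sub_eq_zero, ← inner_self_eq_zero (𝕜 := ℝ)]
    nth_rewrite 1 [inner_sub_left]
    rw [(hm.mem_iff _).1 h1, real_inner_smul_left, (hn.mem_iff _).1 h1]
    simp
  have h3 : |c| = 1 := by
    have := hm.norm
    rw [h2, norm_smul, hn.norm, mul_one, Real.norm_eq_abs] at this
    exact this
  have h4 := hm.pos z hz
  rw [h2, real_inner_smul_left] at h4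
  have h5 : 0 < c := pos_of_mul_pos_left h4 (hn.pos z hz).le
  rw [abs_of_pos h5] at h3
  rw [h2, h3, one_smul]

/-- The parameter of the point where the line through `a` and `y` meets the hyperplane through
`p` orthogonal to `n`. -/
noncomputable def hitParam {d : ℕ} (a p n y : E d) : ℝ := ⟪n, p - a⟫_ℝ / ⟪n, y - a⟫_ℝ

theorem IsNormalAwayFrom.hitPoint_sub_mem {d : ℕ} {F : Set (E d)} {a p n y : E d}
    (hn : IsNormalAwayFrom a F n) (hy : ⟪n, y - a⟫_ℝ ≠ 0) :
    a + hitParam a p n y • (y - a) - p ∈ vectorSpan ℝ F := by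
  rw [hn.mem_iff, add_sub_right_comm, inner_add_right, real_inner_smul_right, hitParam,
    div_mul_cancel₀ _ hy, ← inner_add_right, sub_add_sub_cancel, sub_self, inner_zero_right]

theorem IsNormalAwayFrom.eq_hitParam {d : ℕ} {F : Set (E d)} {a p n y : E d}
    (hn : IsNormalAwayFrom a F n) (hp : p ∈ F) {t : ℝ} (ht : a + t • (y - a) ∈ F) :
    ⟪n, y - a⟫_ℝ ≠ 0 ∧ t = hitParam a p n y := by
  have h1 := hn.inner_sub_eq_zero ht hp
  rw [add_sub_right_comm, inner_add_right, real_inner_smul_right] at h1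
  have h2 := hn.pos p hp
  have h3 : ⟪n, a - p⟫_ℝ = -⟪n, p - a⟫_ℝ := by rw [← inner_neg_right, neg_sub]
  have h4 : ⟪n, y - a⟫_ℝ ≠ 0 := by
    intro h
    rw [h, h3] at h1
    linarith
  refine ⟨h4, ?_⟩
  rw [hitParam, eq_div_iff h4]
  linarith

theorem continuousAt_hitParam {d : ℕ} {a p n y : E d} (hy : ⟪n, y - a⟫_ℝ ≠ 0) :
    ContinuousAt (hitParam a p n) y :=
  continuousAt_const.div (by fun_prop) hy

/-- A hyperface crossed by the segment from `a` to `x` in a relative interior point is crossed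
by the neighbouring segments from `a`. -/
theorem IsNormalAwayFrom.eventually_inter_segment_nonempty {d : ℕ} {F : Set (E d)} {a p n x : E d}
    (hn : IsNormalAwayFrom a F n) (hp : IsRelInterior F p) (hpx : p ∈ segment ℝ a x)
    (hx : x ∉ F) : ∀ᶠ y in 𝓝 x, (F ∩ segment ℝ a y).Nonempty := by
  obtain ⟨t, ht0, ht1, rfl⟩ := mem_segment_iff_exists_add_smul.1 hpx
  set p := a + t • (x - a) with hpdef
  have hpF := hp.mem
  obtain ⟨h1, h2⟩ := hn.eq_hitParam hpF hpF
  have hpos := hn.pos p hpF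
  have ht0' : t ≠ 0 := by
    rintro rfl
    rw [hpdef] at hpos
    simp at hpos
  have ht1' : t ≠ 1 := by
    rintro rfl
    rw [hpdef] at hpF
    exact hx (by simpa using hpF)
  obtain ⟨r, hr, hb⟩ := hp
  have hc := continuousAt_hitParam (p := p) h1
  have hev1 : ∀ᶠ y in 𝓝 x, hitParam a p n y ∈ Set.Ioo (0 : ℝ) 1 := by
    refine hc.eventually_mem (isOpen_Ioo.mem_nhds ?_)
    rw [← h2]
    exact ⟨lt_of_le_of_ne ht0 ht0'.symm, lt_of_le_of_ne ht1 ht1'⟩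
  have hc2 : ContinuousAt (fun y => ‖a + hitParam a p n y • (y - a) - p‖) x := by
    fun_prop
  have hev2 : ∀ᶠ y in 𝓝 x, ‖a + hitParam a p n y • (y - a) - p‖ < r := by
    refine hc2.eventually_lt continuousAt_const ?_
    rw [← h2, ← hpdef, sub_self, norm_zero]
    exact hr
  have hev3 : ∀ᶠ y in 𝓝 x, ⟪n, y - a⟫_ℝ ≠ 0 :=
    (show ContinuousAt (fun y => ⟪n, y - a⟫_ℝ) x by fun_prop).eventually_ne h1
  filter_upwards [hev1, hev2, hev3] with y hy1 hy2 hy3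
  have := hb _ (hn.hitPoint_sub_mem hy3) hy2
  rw [add_sub_cancel] at this
  exact ⟨_, this, mem_segment_iff_exists_add_smul.2 ⟨_, hy1.1.le, hy1.2.le, rfl⟩⟩

/-- Avoiding a closed set is an open condition uniformly in the parameter, by compactness of `[0,
1]`. -/
theorem eventually_not_inter_segment_nonempty {d : ℕ} {F : Set (E d)} (hF : IsClosed F) {a x : E d}
    (h : ¬ (F ∩ segment ℝ a x).Nonempty) : ∀ᶠ y in 𝓝 x, ¬ (F ∩ segment ℝ a y).Nonempty := by
  have key : ∀ᶠ y in 𝓝 x, ∀ t ∈ Set.Icc (0 : ℝ) 1, a + t • (y - a) ∉ F := by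
    refine isCompact_Icc.eventually_forall_of_forall_eventually fun t ht => ?_
    have hc : Continuous fun z : E d × ℝ => a + z.2 • (z.1 - a) := by fun_prop
    refine hc.continuousAt.eventually_mem (hF.isOpen_compl.mem_nhds fun hmem => h ?_)
    exact ⟨_, hmem, mem_segment_iff_exists_add_smul.2 ⟨t, ht.1, ht.2, rfl⟩⟩
  filter_upwards [key] with y hy
  rintro ⟨q, hqF, hq⟩
  obtain ⟨t, h0, h1, rfl⟩ := mem_segment_iff_exists_add_smul.1 hq
  exact hy t ⟨h0, h1⟩ hqF

theorem IsNormalTiling.isClosed_of_mem_facets {d : ℕ} {T : Set (Set (E d))}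
    (hT : IsNormalTiling T) {F : Set (E d)} (hF : F ∈ facets T) : IsClosed F := by
  obtain ⟨C, hC, hF⟩ := hF
  exact hF.1.isClosed (hT.polytope C hC)

theorem IsNormalTiling.isRelInterior_of_mem_facets {d : ℕ} {T : Set (Set (E d))}
    (hT : IsNormalTiling T) {F : Set (E d)} (hF : F ∈ facets T) {p : E d} (hp : p ∈ F)
    (hps : p ∉ skel T 2) : IsRelInterior F p := by
  obtain ⟨C, hC, hF⟩ := hF
  exact hT.isRelInterior hC hF.1 (by have := hF.2; omega) hp hps

/-! ### Hyperfaces around a ridge -/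

/-- If `K ∩ M` were a proper face of `K`, its smaller dimension would put `p` into `skel T j`. -/
theorem IsFace.subset_of_mem {d : ℕ} {T : Set (Set (E d))} {C K M : Set (E d)}
    (hC : C ∈ T) (hK : IsFace C K) (hM : IsFace C M) {j : ℕ} (hj : dim K + j ≤ d + 1) {p : E d}
    (hpK : p ∈ K) (hpM : p ∈ M) (hp : p ∉ skel T j) : K ⊆ M := by
  have hface := hK.inter hM ⟨p, hpK, hpM⟩
  by_contra h
  have hne : K ∩ M ≠ K := fun heq => h (Set.inter_eq_left.1 heq)
  have := (IsFace.of_subset hK.subset hface Set.inter_subset_left).dim_lt hne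
  exact hp (hface.mem_skel hC (by omega) ⟨hpK, hpM⟩)

/-- A point of codimension exactly two lies on a ridge that is a face of all cells at this point,
and is contained in all their faces at this point. -/
theorem IsNormalTiling.exists_ridge {d : ℕ} {T : Set (Set (E d))} (hT : IsNormalTiling T)
    {p : E d} (hp : p ∈ skel T 2) (hp3 : p ∉ skel T 3) :
    ∃ K ∈ ridges T, p ∈ K ∧ (∀ C ∈ T, p ∈ C → IsRidge C K) ∧
      ∀ C ∈ T, ∀ M, IsFace C M → p ∈ M → K ⊆ M := by
  obtain ⟨K, ⟨C₀, hC₀, hK, hdim⟩, hpK⟩ := hp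
  have hdim' : dim K + 2 = d := by
    by_contra h
    exact hp3 (hK.mem_skel hC₀ (by omega) hpK)
  have h1 : ∀ C ∈ T, p ∈ C → IsRidge C K := by
    intro C hC hpC
    refine ⟨?_, hdim'⟩
    rcases eq_or_ne C C₀ with rfl | hne
    · exact hK
    obtain ⟨hf, hf₀⟩ := hT.inter_isFace hC hC₀ hne hpC (hK.subset hpK)
    have hsub : K ⊆ C ∩ C₀ := hK.subset_of_mem hC₀ hf₀ (j := 3) (by omega) hpK
      ⟨hpC, hK.subset hpK⟩ hp3
    exact hf.trans (hT.polytope C hC) (IsFace.of_subset Set.inter_subset_right hK hsub)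
  refine ⟨K, ⟨C₀, hC₀, hK, hdim'⟩, hpK, h1, fun C hC M hM hpM => ?_⟩
  exact (h1 C hC (hM.subset hpM)).1.subset_of_mem hC hM (j := 3) (by omega) hpK hpM hp3

/-- Near a relative interior point of a ridge `K`, a hyperface `F` containing `K` is a half of the
affine hull of `F`. -/
theorem IsFace.exists_half_space {d : ℕ} {F K : Set (E d)} (hF : Convex ℝ F) (hK : IsFace F K)
    (hdim : dim K + 1 = dim F) {p : E d} (hp : IsRelInterior K p) :
    ∃ μ : StrongDual ℝ (E d), (∀ v ∈ vectorSpan ℝ K, μ v = 0) ∧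
      (∀ v ∈ vectorSpan ℝ F, μ v = 0 → v ∈ vectorSpan ℝ K) ∧
      (∀ g ∈ K, ∀ x ∈ F, 0 ≤ μ (x - g)) ∧ (∀ g ∈ K, ∀ x ∈ F, x ∉ K → 0 < μ (x - g)) ∧
      (∃ u ∈ vectorSpan ℝ F, μ u = 1) ∧
      ∃ r > 0, ∀ v ∈ vectorSpan ℝ F, ‖v‖ < r → 0 ≤ μ v → p + v ∈ F := by
  obtain ⟨l, h0, h1, h2⟩ := hK.exists_functional
  obtain ⟨x, hx, hxK⟩ : ∃ x ∈ F, x ∉ K := by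
    by_contra! h
    rw [hK.subset.antisymm h] at hdim
    omega
  have hpK := hp.mem
  obtain ⟨r, hr, hb⟩ := hp
  have hxp : x - p ∈ vectorSpan ℝ F := vsub_mem_vectorSpan ℝ hx (hK.subset hpK)
  have hlx := h2 p hpK x hx hxK
  have hker : ∀ v ∈ vectorSpan ℝ F, l v = 0 → v ∈ vectorSpan ℝ K := by
    have hlt : vectorSpan ℝ F ⊓ LinearMap.ker l.toLinearMap < vectorSpan ℝ F := by
      refine lt_of_le_of_ne inf_le_left fun h => hlx.ne ?_
      have : x - p ∈ vectorSpan ℝ F ⊓ LinearMap.ker l.toLinearMap := by rw [h]; exact hxp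
      exact this.2
    have h3 := Submodule.finrank_lt_finrank_of_lt hlt
    have heq : vectorSpan ℝ K = vectorSpan ℝ F ⊓ LinearMap.ker l.toLinearMap := by
      refine Submodule.eq_of_le_of_finrank_le
        (le_inf (vectorSpan_mono ℝ hK.subset) fun v hv => h0 v hv) ?_
      rw [dim, dim] at hdim
      omega
    intro v hv hlv
    rw [heq]
    exact ⟨hv, hlv⟩
  obtain ⟨r', hr', h⟩ := exists_half_ball_subset hF hr
    (fun v hv hvr => hK.subset (hb v hv hvr)) hx l h0 hlx.ne
  refine ⟨-l, fun v hv => by simp [h0 v hv], fun v hv hlv => hker v hv (by simpa using hlv),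
    fun g hg y hy => by simpa using h1 g hg y hy, fun g hg y hy hyK => ?_,
    ⟨(-(l (x - p)))⁻¹ • (x - p), Submodule.smul_mem _ _ hxp, ?_⟩, r', hr', fun v hv hvr hlv => ?_⟩
  · have := h2 g hg y hy hyK
    rw [neg_apply]
    linarith
  · rw [neg_apply, map_smul, smul_eq_mul, inv_neg, neg_mul, neg_neg, inv_mul_cancel₀ hlx.ne]
  · rw [neg_apply, Left.nonneg_neg_iff] at hlv
    have hv' : v - (l v / l (x - p)) • (x - p) ∈ vectorSpan ℝ K := by
      refine hker _ (sub_mem hv (Submodule.smul_mem _ _ hxp)) ?_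
      rw [map_sub l v, map_smul, smul_eq_mul, div_mul_cancel₀ _ hlx.ne, sub_self]
    have := h _ hv' (l v / l (x - p)) (div_nonneg_of_nonpos hlv hlx.le) (by simpa using hvr)
    simpa using this

/-- The oriented area form of the plane with the orthonormal basis `(e₁, e₂)`. -/
noncomputable def areaForm {d : ℕ} (e₁ e₂ u v : E d) : ℝ :=
  ⟪e₁, u⟫_ℝ * ⟪e₂, v⟫_ℝ - ⟪e₂, u⟫_ℝ * ⟪e₁, v⟫_ℝ

section areaForm

variable {d : ℕ} (e₁ e₂ u v w : E d) (c : ℝ)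

theorem areaForm_self : areaForm e₁ e₂ u u = 0 := by
  unfold areaForm; ring

theorem areaForm_swap : areaForm e₁ e₂ v u = -areaForm e₁ e₂ u v := by
  unfold areaForm; ring

theorem areaForm_add_right : areaForm e₁ e₂ u (v + w) = areaForm e₁ e₂ u v + areaForm e₁ e₂ u w := by
  simp only [areaForm, inner_add_right]; ring

theorem areaForm_sub_right : areaForm e₁ e₂ u (v - w) = areaForm e₁ e₂ u v - areaForm e₁ e₂ u w := by
  simp only [areaForm, inner_sub_right]; ring

theorem areaForm_smul_right : areaForm e₁ e₂ u (c • v) = c * areaForm e₁ e₂ u v := by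
  simp only [areaForm, real_inner_smul_right]; ring

theorem areaForm_smul_left : areaForm e₁ e₂ (c • u) v = c * areaForm e₁ e₂ u v := by
  simp only [areaForm, real_inner_smul_right]; ring

theorem areaForm_add_left : areaForm e₁ e₂ (u + v) w = areaForm e₁ e₂ u w + areaForm e₁ e₂ v w := by
  simp only [areaForm, inner_add_right]; ring

end areaForm

section Frame

variable {d : ℕ} {K : Set (E d)} {e₁ e₂ : E d}

theorem exists_isFrameAround (hK : dim K + 2 = d) : ∃ e₁ e₂ : E d, IsFrameAround K e₁ e₂ := by
  have hfr : Module.finrank ℝ (vectorSpan ℝ K)ᗮ = 2 := by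
    have := (vectorSpan ℝ K).finrank_add_finrank_orthogonal
    rw [finrank_euclideanSpace_fin] at this
    rw [dim] at hK
    omega
  let b := (stdOrthonormalBasis ℝ (vectorSpan ℝ K)ᗮ).reindex (finCongr hfr)
  refine ⟨b 0, b 1, ?_, ?_⟩
  · have h1 := b.orthonormal.comp_linearIsometry (vectorSpan ℝ K)ᗮ.subtypeₗᵢ
    convert h1 using 1
    ext i : 1
    fin_cases i <;> rfl
  · have h2 : Submodule.span ℝ (Set.range b) = ⊤ := by
      rw [← OrthonormalBasis.coe_toBasis]
      exact b.toBasis.span_eq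
    have h3 : ({(b 0 : E d), (b 1 : E d)} : Set (E d)) =
        (vectorSpan ℝ K)ᗮ.subtype '' Set.range b := by
      ext x
      simp only [Set.mem_insert_iff, Set.mem_singleton_iff, Set.mem_image, Set.mem_range,
        Submodule.subtype_apply, Fin.exists_fin_two]
      constructor
      · rintro (rfl | rfl)
        · exact ⟨_, Or.inl rfl, rfl⟩
        · exact ⟨_, Or.inr rfl, rfl⟩
      · rintro ⟨y, rfl | rfl, rfl⟩
        · exact Or.inl rfl
        · exact Or.inr rfl
    rw [h3, Submodule.span_image, h2, Submodule.map_top, Submodule.range_subtype]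

theorem IsFrameAround.inner_eq_zero (h : IsFrameAround K e₁ e₂) {v : E d}
    (hv : v ∈ vectorSpan ℝ K) : ⟪e₁, v⟫_ℝ = 0 ∧ ⟪e₂, v⟫_ℝ = 0 := by
  have h1 : e₁ ∈ (vectorSpan ℝ K)ᗮ := h.2 ▸ Submodule.subset_span (by simp)
  have h2 : e₂ ∈ (vectorSpan ℝ K)ᗮ := h.2 ▸ Submodule.subset_span (by simp)
  exact ⟨Submodule.inner_left_of_mem_orthogonal hv h1, Submodule.inner_left_of_mem_orthogonal hv h2⟩

theorem IsFrameAround.mem_vectorSpan (h : IsFrameAround K e₁ e₂) {v : E d}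
    (h₁ : ⟪e₁, v⟫_ℝ = 0) (h₂ : ⟪e₂, v⟫_ℝ = 0) : v ∈ vectorSpan ℝ K := by
  rw [← Submodule.orthogonal_orthogonal (vectorSpan ℝ K), ← h.2, Submodule.mem_orthogonal]
  intro u hu
  obtain ⟨a, b, rfl⟩ := Submodule.mem_span_pair.1 hu
  rw [inner_add_left, real_inner_smul_left, real_inner_smul_left, h₁, h₂]
  simp

theorem IsFrameAround.areaForm_right (h : IsFrameAround K e₁ e₂) (u : E d) {v : E d}
    (hv : v ∈ vectorSpan ℝ K) : areaForm e₁ e₂ u v = 0 := by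
  obtain ⟨h1, h2⟩ := h.inner_eq_zero hv
  rw [areaForm, h1, h2]; ring

/-- Two vectors with zero area are dependent modulo the direction of the ridge. -/
theorem IsFrameAround.mem_sup_of_areaForm_eq_zero (h : IsFrameAround K e₁ e₂) {u v : E d}
    (hu : u ∉ vectorSpan ℝ K) (huv : areaForm e₁ e₂ u v = 0) :
    v ∈ Submodule.span ℝ {u} ⊔ vectorSpan ℝ K := by
  have key : ∃ c : ℝ, v - c • u ∈ vectorSpan ℝ K := by
    unfold areaForm at huv
    by_cases h1 : ⟪e₁, u⟫_ℝ = 0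
    · have h2 : ⟪e₂, u⟫_ℝ ≠ 0 := fun h2 => hu (h.mem_vectorSpan h1 h2)
      rw [h1, zero_mul, zero_sub, neg_eq_zero, mul_eq_zero, or_iff_right h2] at huv
      refine ⟨⟪e₂, v⟫_ℝ / ⟪e₂, u⟫_ℝ, h.mem_vectorSpan ?_ ?_⟩
      · rw [inner_sub_right, real_inner_smul_right, h1, huv]; simp
      · rw [inner_sub_right, real_inner_smul_right, div_mul_cancel₀ _ h2, sub_self]
    · refine ⟨⟪e₁, v⟫_ℝ / ⟪e₁, u⟫_ℝ, h.mem_vectorSpan ?_ ?_⟩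
      · rw [inner_sub_right, real_inner_smul_right, div_mul_cancel₀ _ h1, sub_self]
      · rw [inner_sub_right, real_inner_smul_right]
        field_simp
        linarith
  obtain ⟨c, hc⟩ := key
  have : v = c • u + (v - c • u) := by abel
  rw [this]
  exact Submodule.add_mem_sup (Submodule.smul_mem _ _ (Submodule.mem_span_singleton_self u)) hc

/-- Zero area would make `n` a combination of `u` and a direction of `K`; being orthogonal to both,
`n` would vanish. -/
theorem IsFrameAround.areaForm_normal_ne_zero (h : IsFrameAround K e₁ e₂) {u n : E d}
    (hu : u ∉ vectorSpan ℝ K) (hn1 : ‖n‖ = 1) (hn : ∀ v ∈ vectorSpan ℝ K, ⟪n, v⟫_ℝ = 0)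
    (hnu : ⟪n, u⟫_ℝ = 0) : areaForm e₁ e₂ u n ≠ 0 := by
  intro h0
  have hmem := h.mem_sup_of_areaForm_eq_zero hu h0
  obtain ⟨y, hy, z, hz, hyz⟩ := Submodule.mem_sup.1 hmem
  obtain ⟨c, rfl⟩ := Submodule.mem_span_singleton.1 hy
  have : ⟪n, n⟫_ℝ = 0 := by
    nth_rewrite 2 [← hyz]
    rw [inner_add_right, real_inner_smul_right, hnu, hn z hz]
    simp
  rw [real_inner_self_eq_norm_sq, hn1] at this
  norm_num at this

end Frame

/-- Let `F` be a hyperface containing the ridge `K`, and let the segment from `a` to `x` meet `K`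
at `p`. When `x` moves with velocity `v` transversal to the hyperplane through `a` and `K`,
the segment starts or stops crossing `F` according to the sign of a number which also says whether
the normal to `F` that points away from `a` is coherent with the frame. -/
theorem IsNormalAwayFrom.exists_crossing_sign {d : ℕ} {F K : Set (E d)} (hF : Convex ℝ F)
    (hK : IsFace F K) (hdim : dim K + 1 = dim F) {p : E d} (hp : IsRelInterior K p) {e₁ e₂ : E d}
    (he : IsFrameAround K e₁ e₂) {a n : E d} (hn : IsNormalAwayFrom a F n) :
    ∃ η : ℝ, η ≠ 0 ∧ (∀ g ∈ K, ∀ x ∈ F \ K, 0 < η * areaForm e₁ e₂ (x - g) n) ∧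
      ∀ x v, (∃ θ : ℝ, 0 < θ ∧ θ < 1 ∧ p = a + θ • (x - a)) → areaForm e₁ e₂ (x - a) v ≠ 0 →
        ∀ᶠ t : ℝ in 𝓝[≠] 0, ((F ∩ segment ℝ a (x + t • v)).Nonempty ↔
          t * areaForm e₁ e₂ (x - a) v * η < 0) := by
  obtain ⟨μ, hμK, hμF, hμ0, hμ1, ⟨u, hu, hμu⟩, r, hr, hball⟩ := hK.exists_half_space hF hdim hp
  have hpK := hp.mem
  have hpF := hK.subset hpK
  have hKn : ∀ v ∈ vectorSpan ℝ K, ⟪n, v⟫_ℝ = 0 := fun v hv =>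
    (hn.mem_iff v).1 (vectorSpan_mono ℝ hK.subset hv)
  have hrest : ∀ v ∈ vectorSpan ℝ F, v - μ v • u ∈ vectorSpan ℝ K := fun v hv => by
    refine hμF _ (sub_mem hv (Submodule.smul_mem _ _ hu)) ?_
    rw [map_sub, map_smul, hμu, smul_eq_mul, mul_one, sub_self]
  have hright : ∀ w, ∀ v ∈ vectorSpan ℝ F,
      areaForm e₁ e₂ w v = μ v * areaForm e₁ e₂ w u := fun w v hv => by
    have h1 := he.areaForm_right w (hrest v hv)
    rw [areaForm_sub_right, areaForm_smul_right] at h1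
    linarith
  have hFF : ∀ w ∈ vectorSpan ℝ F, ∀ v ∈ vectorSpan ℝ F, areaForm e₁ e₂ w v = 0 :=
    fun w hw v hv => by
      rw [hright w v hv, areaForm_swap, hright u w hw, areaForm_self]; simp
  -- Here `u` points from `K` into `F`, so the sign of `η` tells whether `n` lies on the
  -- counterclockwise side of `F`.
  set η := areaForm e₁ e₂ u n with hη
  have hη0 : η ≠ 0 := he.areaForm_normal_ne_zero
    (fun h => by rw [hμK u h] at hμu; exact zero_ne_one hμu) hn.norm hKn ((hn.mem_iff u).1 hu)
  have hηv : ∀ v ∈ vectorSpan ℝ F, areaForm e₁ e₂ v n = η * μ v := fun v hv => by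
    rw [areaForm_swap, hright n v hv, areaForm_swap]; ring
  set β := ⟪n, p - a⟫_ℝ with hβ
  have hβ0 : 0 < β := hn.pos p hpF
  -- Only the normal component `β • n` of `p - a` contributes, because the area form vanishes on
  -- pairs of directions of `F`.
  have hκ : ∀ v ∈ vectorSpan ℝ F, areaForm e₁ e₂ (p - a) v = -(β * η * μ v) := fun v hv => by
    have hw : p - a - β • n ∈ vectorSpan ℝ F := by
      rw [hn.mem_iff, inner_sub_right, real_inner_smul_right, hn.inner_self, mul_one, sub_self]
    have h1 : p - a = β • n + (p - a - β • n) := by abel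
    rw [h1, areaForm_add_left, areaForm_smul_left, hFF _ hw v hv, areaForm_swap, hηv v hv]
    ring
  refine ⟨η, hη0, fun g hg x hx => ?_, ?_⟩
  · rw [← vsub_eq_sub x g, hηv _ (vsub_mem_vectorSpan ℝ hx.1 (hK.subset hg))]
    have := hμ1 g hg x hx.1 hx.2
    have := mul_pos (pow_pos (abs_pos.2 hη0) 2) this
    rw [sq_abs] at this
    simp only [vsub_eq_sub]
    linarith
  · rintro x v ⟨θ, hθ0, hθ1, hpx⟩ hD
    set D := areaForm e₁ e₂ (x - a) v with hDdef
    have hpx' : p - a = θ • (x - a) := by rw [hpx, add_sub_cancel_left]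
    obtain ⟨h1, h2⟩ := hn.eq_hitParam hpF (y := x) (t := θ) (hpx ▸ hpF)
    have hxpos : 0 < ⟪n, x - a⟫_ℝ := by
      have : β = θ * ⟪n, x - a⟫_ℝ := by rw [hβ, hpx', real_inner_smul_right]
      rw [this] at hβ0
      exact pos_of_mul_pos_right hβ0 hθ0.le
    have hline : ContinuousAt (fun t : ℝ => x + t • v) 0 := by fun_prop
    have hx0 : x + (0 : ℝ) • v = x := by simp
    have hc : ContinuousAt (fun t : ℝ => hitParam a p n (x + t • v)) 0 :=
      ContinuousAt.comp (g := hitParam a p n) (by rw [hx0]; exact continuousAt_hitParam h1) hline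
    have hev1 : ∀ᶠ t : ℝ in 𝓝 0, hitParam a p n (x + t • v) ∈ Set.Ioo (0 : ℝ) 1 := by
      refine hc.eventually_mem (isOpen_Ioo.mem_nhds ?_)
      rw [hx0, ← h2]
      exact ⟨hθ0, hθ1⟩
    have hev2 : ∀ᶠ t : ℝ in 𝓝 0,
        ‖a + hitParam a p n (x + t • v) • (x + t • v - a) - p‖ < r := by
      have hc2 : ContinuousAt
          (fun t : ℝ => ‖a + hitParam a p n (x + t • v) • (x + t • v - a) - p‖) 0 := by
        fun_prop
      refine hc2.eventually_lt continuousAt_const ?_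
      rw [hx0, ← h2, ← hpx, sub_self, norm_zero]
      exact hr
    have hev3 : ∀ᶠ t : ℝ in 𝓝 0, ⟪n, x + t • v - a⟫_ℝ ≠ 0 :=
      (show ContinuousAt (fun t : ℝ => ⟪n, x + t • v - a⟫_ℝ) 0 by fun_prop).eventually_ne
        (by rw [hx0]; exact h1)
    filter_upwards [nhdsWithin_le_nhds hev1, nhdsWithin_le_nhds hev2, nhdsWithin_le_nhds hev3,
      self_mem_nhdsWithin] with t ht1 ht2 ht3 ht0
    set y := x + t • v with hy
    set θ' := hitParam a p n y with hθ'
    have hw := hn.hitPoint_sub_mem (p := p) ht3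
    set w := a + θ' • (y - a) - p with hwdef
    have hya : y - a = (x - a) + t • v := by rw [hy]; abel
    -- `w` is the displacement, within the hyperplane of `F`, of the hit point from `p`. This
    -- identity turns the sign of `μ w`, which decides whether the hit point is in `F`, into the
    -- sign of `t * D * η`.
    have hval : -(β * η * μ w) = θ * θ' * (t * D) := by
      have hw' : w = θ' • (y - a) - (p - a) := by rw [hwdef]; abel
      rw [← hκ w hw, hw', areaForm_sub_right, areaForm_self, sub_zero, areaForm_smul_right, hpx',
        areaForm_smul_left, hya, areaForm_add_right, areaForm_self, areaForm_smul_right]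
      ring
    have hμw : μ w ≠ 0 := by
      intro h
      rw [h] at hval
      have : θ * θ' * (t * D) ≠ 0 := by
        have := ht1.1.ne'
        have := hθ0.ne'
        have : t ≠ 0 := ht0
        positivity
      exact this (by rw [← hval]; ring)
    have hiff1 : (F ∩ segment ℝ a y).Nonempty ↔ a + θ' • (y - a) ∈ F := by
      constructor
      · rintro ⟨q, hqF, hq⟩
        obtain ⟨τ, -, -, rfl⟩ := mem_segment_iff_exists_add_smul.1 hq
        rwa [(hn.eq_hitParam hpF hqF).2] at hqF
      · exact fun h => ⟨_, h, mem_segment_iff_exists_add_smul.2 ⟨_, ht1.1.le, ht1.2.le, rfl⟩⟩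
    have hiff2 : a + θ' • (y - a) ∈ F ↔ 0 < μ w := by
      constructor
      · exact fun h => lt_of_le_of_ne (hμ0 p hpK _ h) hμw.symm
      · intro h
        have := hball w hw ht2 h.le
        rwa [hwdef, add_sub_cancel] at this
    rw [hiff1, hiff2]
    have hθθ : 0 < θ * θ' := mul_pos hθ0 ht1.1
    have hη2 : 0 < β * η ^ 2 := by positivity
    have hval2 : t * D * η * (θ * θ') = -(β * η ^ 2 * μ w) := by
      linear_combination (-η) * hval
    constructor
    · intro h
      have := mul_pos hη2 h
      by_contra hcon
      push Not at hcon
      nlinarith [mul_nonneg hcon hθθ.le]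
    · intro h
      have := mul_neg_of_neg_of_pos h hθθ
      rw [hval2, neg_lt_zero] at this
      exact pos_of_mul_pos_right this hη2.le

/-! ### Sums over the hyperfaces crossed by a segment -/

section CrossSum

variable {d : ℕ} {V : Type*} [AddCommGroup V]

/-- The sum of the weights of the hyperfaces crossed by the segment from `a` to `y`. -/
noncomputable def crossSum (T : Set (Set (E d))) (a : E d) (w : Set (E d) → V) (y : E d) : V :=
  ∑ᶠ F ∈ {F | F ∈ facets T ∧ (F ∩ segment ℝ a y).Nonempty}, w F

open Classical in
/-- The contribution of the hyperface `F` to `crossSum`. -/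
noncomputable def crossTerm (a : E d) (w : Set (E d) → V) (F : Set (E d)) (y : E d) : V :=
  if (F ∩ segment ℝ a y).Nonempty then w F else 0

theorem crossSum_eq_sum {T : Set (Set (E d))} {a : E d} (w : Set (E d) → V) {y : E d}
    {S : Finset (Set (E d))} (hS : ∀ F ∈ S, F ∈ facets T)
    (hS' : ∀ F ∈ facets T, (F ∩ segment ℝ a y).Nonempty → F ∈ S) :
    crossSum T a w y = ∑ F ∈ S, crossTerm a w F y := by
  classical
  have : {F | F ∈ facets T ∧ (F ∩ segment ℝ a y).Nonempty} =
      ((S.filter fun F => (F ∩ segment ℝ a y).Nonempty : Finset (Set (E d))) : Set (Set (E d))) := by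
    ext F
    simp only [Set.mem_ofPred_eq, Finset.coe_filter]
    exact ⟨fun h => ⟨hS' F h.1 h.2, h.2⟩, fun h => ⟨hS F h.1, h.2⟩⟩
  rw [crossSum, this, finsum_mem_coe_finset, Finset.sum_filter]
  exact Finset.sum_congr rfl fun F _ => by rw [crossTerm]

theorem crossTerm_congr {a : E d} (w : Set (E d) → V) {F : Set (E d)} {x y : E d}
    (h : (F ∩ segment ℝ a y).Nonempty ↔ (F ∩ segment ℝ a x).Nonempty) :
    crossTerm a w F y = crossTerm a w F x := by
  by_cases hx : (F ∩ segment ℝ a x).Nonempty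
  · rw [crossTerm, crossTerm, if_pos hx, if_pos (h.2 hx)]
  · rw [crossTerm, crossTerm, if_neg hx, if_neg (mt h.1 hx)]

/-- One finite index set serves all endpoints near `x`, so that crossing sums at different endpoints
can be compared term by term. -/
theorem IsParallelohedralTiling.exists_finset_crossSum {P : Set (E d)} {T : Set (Set (E d))}
    (hT : IsParallelohedralTiling P T) (a x : E d) :
    ∃ S : Finset (Set (E d)), (∀ F ∈ S, F ∈ facets T) ∧
      ∀ᶠ y in 𝓝 x, ∀ F ∈ facets T, (F ∩ segment ℝ a y).Nonempty → F ∈ S := by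
  set R := max ‖a‖ (‖x‖ + 1) with hR
  have hfin := hT.finite_facets_inter_nonempty
    (Metric.isBounded_closedBall (x := (0 : E d)) (r := R))
  refine ⟨hfin.toFinset, fun F hF => ((Set.Finite.mem_toFinset hfin).1 hF).1, ?_⟩
  have : ∀ᶠ y in 𝓝 x, ‖y‖ < ‖x‖ + 1 :=
    continuous_norm.continuousAt.eventually_lt continuousAt_const (by simp)
  filter_upwards [this] with y hy F hF hne
  refine (Set.Finite.mem_toFinset hfin).2 ⟨hF, hne.mono (Set.inter_subset_inter_right _ ?_)⟩
  refine (convex_closedBall (0 : E d) R).segment_subset ?_ ?_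
  · rw [mem_closedBall_zero_iff]; exact le_max_left _ _
  · rw [mem_closedBall_zero_iff]; exact hy.le.trans (le_max_right _ _)

/-- A base point in general position with respect to the hyperfaces and the ridges. -/
structure IsGenericBase (T : Set (Set (E d))) (a : E d) : Prop where
  notMem_affineSpan : ∀ F ∈ facets T, a ∉ affineSpan ℝ F
  notMem_skel : a ∉ skel T 2

variable {P : Set (E d)} {T : Set (Set (E d))} {a : E d}

theorem IsNormalTiling.eventually_crosses_iff (hT : IsNormalTiling T) (ha : IsGenericBase T a)
    {F : Set (E d)} (hF : F ∈ facets T) {x : E d} (hx : x ∉ F)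
    (h : ∀ p ∈ F ∩ segment ℝ a x, p ∉ skel T 2) :
    ∀ᶠ y in 𝓝 x, ((F ∩ segment ℝ a y).Nonempty ↔ (F ∩ segment ℝ a x).Nonempty) := by
  by_cases hne : (F ∩ segment ℝ a x).Nonempty
  · obtain ⟨p, hpF, hp⟩ := hne
    obtain ⟨n, hn⟩ := hT.exists_isNormalAwayFrom hF (ha.notMem_affineSpan F hF)
    filter_upwards [hn.eventually_inter_segment_nonempty
      (hT.isRelInterior_of_mem_facets hF hpF (h p ⟨hpF, hp⟩)) hp hx] with y hy
    exact iff_of_true hy ⟨p, hpF, hp⟩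
  · filter_upwards [eventually_not_inter_segment_nonempty (hT.isClosed_of_mem_facets hF) hne]
      with y hy
    exact iff_of_false hy hne

theorem IsParallelohedralTiling.eventually_crossSum_eq (hT : IsParallelohedralTiling P T)
    (ha : IsGenericBase T a) (w : Set (E d) → V) {x : E d} (hx : ∀ F ∈ facets T, x ∉ F)
    (h : ∀ p ∈ segment ℝ a x, p ∉ skel T 2) :
    ∀ᶠ y in 𝓝 x, crossSum T a w y = crossSum T a w x := by
  obtain ⟨S, hS, hS'⟩ := hT.exists_finset_crossSum a x
  have hev : ∀ᶠ y in 𝓝 x, ∀ F ∈ S,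
      ((F ∩ segment ℝ a y).Nonempty ↔ (F ∩ segment ℝ a x).Nonempty) :=
    (Finset.eventually_all S).2 fun F hF =>
      hT.tiling.eventually_crosses_iff ha (hS F hF) (hx F (hS F hF)) fun p hp => h p hp.2
  filter_upwards [hS', hev] with y hy hy'
  rw [crossSum_eq_sum w hS hy, crossSum_eq_sum w hS hS'.self_of_nhds]
  exact Finset.sum_congr rfl fun F hF => crossTerm_congr w (hy' F hF)

variable [Module ℝ V]

/-- The weights balance around every ridge, when they are given signs according to whether the
normals pointing away from `a` are coherent with a frame around the ridge. -/
def IsBalanced (T : Set (Set (E d))) (a : E d) (w : Set (E d) → V) : Prop :=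
  ∀ K ∈ ridges T, ∀ e₁ e₂ : E d, IsFrameAround K e₁ e₂ → ∀ η : Set (E d) → ℝ,
    (∀ F ∈ facetsContaining T K, η F ≠ 0 ∧ ∀ n, IsNormalAwayFrom a F n →
      ∀ g ∈ K, ∀ x ∈ F \ K, 0 < η F * areaForm e₁ e₂ (x - g) n) →
    ∑ᶠ F ∈ facetsContaining T K, (SignType.sign (η F) : ℝ) • w F = 0

theorem sum_sign_smul_eq {ι : Type*} (S : Finset ι) (η : ι → ℝ) (w : ι → V)
    (h : ∑ i ∈ S, (SignType.sign (η i) : ℝ) • w i = 0) :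
    ∑ i ∈ S, (if 0 < η i then w i else 0) = ∑ i ∈ S, (if η i < 0 then w i else 0) := by
  rw [← sub_eq_zero, ← Finset.sum_sub_distrib]
  refine Eq.trans ?_ h
  refine Finset.sum_congr rfl fun i _ => ?_
  rcases lt_trichotomy (η i) 0 with h0 | h0 | h0
  · rw [if_neg h0.not_gt, if_pos h0, sign_neg h0]; simp
  · simp [h0]
  · rw [if_pos h0, if_neg h0.not_gt, sign_pos h0]; simp

/-- The hyperfaces around a ridge contribute the same amount on both sides of the ridge. -/
theorem IsNormalTiling.eventually_sum_crossTerm_eq (hT : IsNormalTiling T)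
    (ha : IsGenericBase T a) {w : Set (E d) → V} (hw : IsBalanced T a w) {x v p : E d}
    (hp : p ∈ skel T 2) (hp3 : p ∉ skel T 3) {θ : ℝ} (h0 : 0 < θ) (h1 : θ < 1)
    (hpx : p = a + θ • (x - a))
    (hv : ∀ K ∈ ridges T, ∀ e₁ e₂, IsFrameAround K e₁ e₂ → areaForm e₁ e₂ (x - a) v ≠ 0)
    {S : Finset (Set (E d))} (hS : ∀ F, F ∈ S ↔ F ∈ facets T ∧ p ∈ F) :
    ∃ c, ∀ᶠ t : ℝ in 𝓝[≠] 0, ∑ F ∈ S, crossTerm a w F (x + t • v) = c := by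
  obtain ⟨K, hK, hpK, hridge, hmin⟩ := hT.exists_ridge hp hp3
  have hKdim : dim K + 2 = d := by obtain ⟨C, -, hC⟩ := hK; exact hC.2
  obtain ⟨e₁, e₂, he⟩ := exists_isFrameAround hKdim
  have hSK : facetsContaining T K = S := by
    ext F
    rw [Finset.mem_coe, hS]
    refine ⟨fun h => ⟨h.1, h.2 hpK⟩, fun h => ⟨h.1, ?_⟩⟩
    obtain ⟨⟨C, hC, hF⟩, hpF⟩ := h
    exact hmin C hC F hF.1 hpF
  have hη : ∀ F, ∃ η : ℝ, F ∈ S → η ≠ 0 ∧ (∀ n, IsNormalAwayFrom a F n →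
      ∀ g ∈ K, ∀ x ∈ F \ K, 0 < η * areaForm e₁ e₂ (x - g) n) ∧
      ∀ᶠ t : ℝ in 𝓝[≠] 0, ((F ∩ segment ℝ a (x + t • v)).Nonempty ↔
          t * areaForm e₁ e₂ (x - a) v * η < 0) := by
    intro F
    by_cases hFS : F ∈ S
    · obtain ⟨hF, hpF⟩ := (hS F).1 hFS
      obtain ⟨n, hn⟩ := hT.exists_isNormalAwayFrom hF (ha.notMem_affineSpan F hF)
      obtain ⟨C, hC, hFC⟩ := hF
      have hCp := hT.polytope C hC
      have hKC := hridge C hC (hFC.1.subset hpF)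
      have hKF : IsFace F K := IsFace.of_subset hFC.1.subset hKC.1 (hmin C hC F hFC.1 hpF)
      have hFdim := hFC.2
      obtain ⟨η, hη0, hη1, hη2⟩ := hn.exists_crossing_sign (hFC.1.convex hCp.convex) hKF
        (by omega) (hT.isRelInterior hC hKC.1 (j := 3) (by omega) hpK hp3) he
      refine ⟨η, fun _ => ⟨hη0, fun n' hn' => ?_, hη2 x v ⟨θ, h0, h1, hpx⟩ (hv K hK e₁ e₂ he)⟩⟩
      rwa [hn'.unique hn hFC.1.1]
    · exact ⟨0, fun h => absurd h hFS⟩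
  choose η hη using hη
  have hbal := hw K hK e₁ e₂ he η fun F hF => by
    rw [hSK] at hF
    exact ⟨(hη F hF).1, (hη F hF).2.1⟩
  rw [hSK, finsum_mem_coe_finset] at hbal
  have hsum := sum_sign_smul_eq S η w hbal
  have hev := (Finset.eventually_all S).2 fun F hF => (hη F hF).2.2
  refine ⟨∑ F ∈ S, (if 0 < η F then w F else 0), ?_⟩
  filter_upwards [hev, self_mem_nhdsWithin] with t ht ht0
  have hD : t * areaForm e₁ e₂ (x - a) v ≠ 0 := mul_ne_zero ht0 (hv K hK e₁ e₂ he)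
  -- On one side of the ridge the crossed facets are those with `η > 0`, on the other those with `η
  -- < 0`; balance makes the two sums equal.
  rcases hD.lt_or_gt with hD | hD
  · refine Finset.sum_congr rfl fun F hF => ?_
    have hiff : t * areaForm e₁ e₂ (x - a) v * η F < 0 ↔ 0 < η F :=
      ⟨fun h => by nlinarith, fun h => by nlinarith⟩
    rw [crossTerm]
    simp only [ht F hF, hiff]
  · rw [hsum]
    refine Finset.sum_congr rfl fun F hF => ?_
    have hiff : t * areaForm e₁ e₂ (x - a) v * η F < 0 ↔ η F < 0 :=
      ⟨fun h => by nlinarith, fun h => by nlinarith⟩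
    rw [crossTerm]
    simp only [ht F hF, hiff]

theorem IsNormalTiling.notMem_facet_of_mem_interior (hT : IsNormalTiling T) {C F : Set (E d)}
    (hC : C ∈ T) {x : E d} (hx : x ∈ interior C) (hF : F ∈ facets T) : x ∉ F :=
  hT.notMem_of_mem_interior hC hx (j := 0) (facets_subset_lowFaces T hF)

/-- The facets are grouped by the point where they meet the segment from `a` to `x`. A group at a
point of a ridge consists of all facets through that point, and its sum is preserved by balance. In
the other groups each facet keeps its crossing status separately. -/
theorem IsParallelohedralTiling.exists_eventually_crossSum_eq (hT : IsParallelohedralTiling P T)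
    (ha : IsGenericBase T a) {w : Set (E d) → V} (hw : IsBalanced T a w) {x v : E d}
    (hx : ∀ F ∈ facets T, x ∉ F) (hx3 : ∀ p ∈ segment ℝ a x, p ∉ skel T 3)
    (hv : ∀ K ∈ ridges T, ∀ e₁ e₂, IsFrameAround K e₁ e₂ → areaForm e₁ e₂ (x - a) v ≠ 0) :
    ∃ c, ∀ᶠ t : ℝ in 𝓝[≠] 0, crossSum T a w (x + t • v) = c := by
  classical
  obtain ⟨S, hS, hS'⟩ := hT.exists_finset_crossSum a x
  have hline : Tendsto (fun t : ℝ => x + t • v) (𝓝[≠] 0) (𝓝 x) := by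
    have : ContinuousAt (fun t : ℝ => x + t • v) 0 := by fun_prop
    have h := this.tendsto
    simp only [zero_smul, add_zero] at h
    exact h.mono_left nhdsWithin_le_nhds
  -- A segment from `a` meets a facet at most once, since `a` is off its hyperplane. Facets that are
  -- not met get the value `a`; as `a` avoids `skel T 2`, they fall into the harmless case.
  let q : Set (E d) → E d := fun F => if h : (F ∩ segment ℝ a x).Nonempty then h.some else a
  have hq : ∀ F, (F ∩ segment ℝ a x).Nonempty → q F ∈ F ∩ segment ℝ a x := fun F h => by
    simp only [q, dif_pos h]
    exact h.some_mem
  have hq' : ∀ F, ¬ (F ∩ segment ℝ a x).Nonempty → q F = a := fun F h => by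
    simp only [q, dif_neg h]
  have key : ∀ p ∈ S.image q, ∃ c, ∀ᶠ t : ℝ in 𝓝[≠] 0,
      ∑ F ∈ S with q F = p, crossTerm a w F (x + t • v) = c := by
    intro p hp
    by_cases hps : p ∈ skel T 2
    · have hpa : p ≠ a := fun h => ha.notMem_skel (h ▸ hps)
      have hmem : ∀ F, q F = p → p ∈ F ∩ segment ℝ a x := fun F hF => by
        by_cases h : (F ∩ segment ℝ a x).Nonempty
        · exact hF ▸ hq F h
        · exact absurd ((hq' F h).symm.trans hF).symm hpa
      obtain ⟨F₀, hF₀, hqF₀⟩ := Finset.mem_image.1 hp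
      have hpx := (hmem F₀ hqF₀).2
      have hpxne : p ≠ x := fun h => hx F₀ (hS F₀ hF₀) (h ▸ (hmem F₀ hqF₀).1)
      obtain ⟨θ, h0, h1, hpθ⟩ := mem_segment_iff_exists_add_smul.1 hpx
      have hθ0 : θ ≠ 0 := by rintro rfl; exact hpa (by simpa using hpθ)
      have hθ1 : θ ≠ 1 := by rintro rfl; exact hpxne (by simpa using hpθ)
      refine hT.tiling.eventually_sum_crossTerm_eq ha hw hps (hx3 p hpx) (h0.lt_of_ne' hθ0)
        (h1.lt_of_ne hθ1) hpθ hv fun F => ?_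
      rw [Finset.mem_filter]
      refine ⟨fun h => ⟨hS F h.1, (hmem F h.2).1⟩, fun h => ?_⟩
      have hne : (F ∩ segment ℝ a x).Nonempty := ⟨p, h.2, hpx⟩
      refine ⟨hS'.self_of_nhds F h.1 hne, ?_⟩
      obtain ⟨n, hn⟩ := hT.tiling.exists_isNormalAwayFrom h.1 (ha.notMem_affineSpan F h.1)
      obtain ⟨hqF, hqx⟩ := hq F hne
      obtain ⟨θ', -, -, hqθ⟩ := mem_segment_iff_exists_add_smul.1 hqx
      rw [hqθ] at hqF
      have e1 := (hn.eq_hitParam h.2 hqF).2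
      have e2 := (hn.eq_hitParam h.2 (hpθ ▸ h.2)).2
      rw [hqθ, e1, ← e2, ← hpθ]
    · refine ⟨∑ F ∈ S with q F = p, crossTerm a w F x, ?_⟩
      have hev : ∀ F ∈ S.filter (fun F => q F = p), ∀ᶠ y in 𝓝 x,
          ((F ∩ segment ℝ a y).Nonempty ↔ (F ∩ segment ℝ a x).Nonempty) := by
        intro F hF
        obtain ⟨hFS, hqF⟩ := Finset.mem_filter.1 hF
        have hFT := hS F hFS
        by_cases hne : (F ∩ segment ℝ a x).Nonempty
        · obtain ⟨n, hn⟩ := hT.tiling.exists_isNormalAwayFrom hFT (ha.notMem_affineSpan F hFT)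
          have hmem := hq F hne
          rw [hqF] at hmem
          filter_upwards [hn.eventually_inter_segment_nonempty
            (hT.tiling.isRelInterior_of_mem_facets hFT hmem.1 hps) hmem.2 (hx F hFT)] with y hy
          exact iff_of_true hy hne
        · filter_upwards [eventually_not_inter_segment_nonempty
            (hT.tiling.isClosed_of_mem_facets hFT) hne] with y hy
          exact iff_of_false hy hne
      filter_upwards [hline.eventually ((Finset.eventually_all _).2 hev)] with t ht
      exact Finset.sum_congr rfl fun F hF => crossTerm_congr w (ht F hF)
  have hc : ∀ p, ∃ c, p ∈ S.image q → ∀ᶠ t : ℝ in 𝓝[≠] 0,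
      ∑ F ∈ S with q F = p, crossTerm a w F (x + t • v) = c := fun p => by
    by_cases hp : p ∈ S.image q
    · obtain ⟨c, hc⟩ := key p hp
      exact ⟨c, fun _ => hc⟩
    · exact ⟨0, fun h => absurd h hp⟩
  choose c hc using hc
  refine ⟨∑ p ∈ S.image q, c p, ?_⟩
  filter_upwards [hline.eventually hS', (Finset.eventually_all _).2 hc] with t ht hct
  rw [crossSum_eq_sum w hS ht,
    ← Finset.sum_fiberwise_of_maps_to (fun F hF => Finset.mem_image_of_mem q hF)]
  exact Finset.sum_congr rfl hct

end CrossSum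

/-- A function on `[0, 1]` that is constant on a punctured neighbourhood of each point takes the
same value at the ends, if it is locally constant there. -/
theorem eq_of_eventually_punctured_eq {V : Type*} {h : ℝ → V}
    (hloc : ∀ t ∈ Set.Icc (0 : ℝ) 1, ∃ c, ∀ᶠ s in 𝓝[≠] t, h s = c)
    (h0 : ∀ᶠ s in 𝓝 0, h s = h 0) (h1 : ∀ᶠ s in 𝓝 1, h s = h 1) : h 0 = h 1 := by
  have hloc' : ∀ t, ∃ c, t ∈ Set.Icc (0 : ℝ) 1 → ∀ᶠ s in 𝓝[≠] t, h s = c := fun t => by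
    by_cases ht : t ∈ Set.Icc (0 : ℝ) 1
    · obtain ⟨c, hc⟩ := hloc t ht
      exact ⟨c, fun _ => hc⟩
    · exact ⟨h 0, fun h => absurd h ht⟩
  choose v hv using hloc'
  have huniq : ∀ t ∈ Set.Icc (0 : ℝ) 1, ∀ c, (∀ᶠ s in 𝓝[≠] t, h s = c) → v t = c := by
    intro t ht c hc
    obtain ⟨s, hs1, hs2⟩ := ((hv t ht).and hc).exists
    exact hs1.symm.trans hs2
  have hmain : v 0 = v 1 := by
    refine isPreconnected_Icc.induction₂ (s := Set.Icc (0 : ℝ) 1) (fun s t => v s = v t)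
      (fun t ht => ?_) (fun _ _ _ _ _ _ => Eq.trans) (fun _ _ _ _ => Eq.symm)
      (by simp) (by simp)
    -- A point `s ≠ t` close to `t` has a whole neighbourhood on which `h` takes the value `v t`, so
    -- `v s = v t`.
    have hev := eventually_nhdsWithin_iff.1 (eventually_nhdsNE_eventually_nhds_iff.2 (hv t ht))
    filter_upwards [nhdsWithin_le_nhds hev, self_mem_nhdsWithin] with s hs hsI
    rcases eq_or_ne s t with rfl | hst
    · rfl
    · exact (huniq s hsI _ (nhdsWithin_le_nhds (hs hst))).symm
  rw [← huniq 0 (by simp) _ (nhdsWithin_le_nhds h0), hmain,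
    huniq 1 (by simp) _ (nhdsWithin_le_nhds h1)]

/-! ### The potential of balanced weights -/

section Potential

variable {d : ℕ} {V : Type*} [AddCommGroup V] [Module ℝ V] {P : Set (E d)} {T : Set (Set (E d))}
  {a : E d}

theorem IsGenericFrom.sub_notMem_vectorSpan {x : E d} (h : IsGenericFrom T a x) {K : Set (E d)}
    (hK : K ∈ lowFaces T 2) : x - a ∉ vectorSpan ℝ K := by
  intro hmem
  refine h K hK ?_
  have h1 : x - a ∈ (affineSpan ℝ (insert a K)).direction := by
    rw [direction_affineSpan]
    exact vectorSpan_mono ℝ (Set.subset_insert _ _) hmem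
  have := AffineSubspace.vadd_mem_of_mem_direction h1
    (subset_affineSpan ℝ _ (Set.mem_insert a K))
  simpa using this

/-- The triangle with the vertices `a`, `x`, `z` is in general position with respect to the faces
of codimension at least two. -/
structure IsGenericTriangle (T : Set (Set (E d))) (a x z : E d) : Prop where
  notMem_affineSpan : ∀ K ∈ lowFaces T 3, z ∉ affineSpan ℝ (insert a (insert x K))
  notMem_sup : ∀ K ∈ lowFaces T 2, z - a ∉ Submodule.span ℝ {x - a} ⊔ vectorSpan ℝ K

theorem ridges_subset_lowFaces (T : Set (Set (E d))) : ridges T ⊆ lowFaces T 2 :=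
  fun _ ⟨C, hC, hK⟩ => ⟨C, hC, hK.1, hK.2.le⟩

/-- A point `p` strictly off the line `a x` determines, together with `a` and `x`, the vertex `z`;
so `p ∈ K` would put `z` into an excluded hull. Points with `s * t = 0` are on that line, where
genericity of `x` suffices. -/
theorem IsGenericTriangle.notMem_skel {x z p : E d} (h : IsGenericTriangle T a x z)
    (ha : a ∉ skel T 2) (hx : IsGenericFrom T a x) {t : ℝ}
    (hp : p ∈ segment ℝ a (x + t • (z - x))) : p ∉ skel T 3 := by
  rintro ⟨K, hK, hpK⟩
  obtain ⟨s, -, -, hps⟩ := mem_segment_iff_exists_add_smul.1 hp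
  by_cases hst : s * t = 0
  · have hp' : p = a + s • (x - a) := by
      rw [hps, add_sub_right_comm, smul_add, smul_smul, hst, zero_smul, add_zero]
    refine absurd ⟨K, lowFaces_mono T (by norm_num) hK, hpK⟩ (?_ : p ∉ skel T 2)
    rcases eq_or_ne s 0 with rfl | hs
    · rw [hp', zero_smul, add_zero]
      exact ha
    · rw [hp']
      exact (hx.lineMap hs).notMem_skel
  · refine h.notMem_affineSpan K hK ?_
    have ha' : a ∈ affineSpan ℝ (insert a (insert x K)) := subset_affineSpan ℝ _ (by simp)
    have hx' : x ∈ affineSpan ℝ (insert a (insert x K)) := subset_affineSpan ℝ _ (by simp)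
    have hp' : p ∈ affineSpan ℝ (insert a (insert x K)) := subset_affineSpan ℝ _ (by simp [hpK])
    have h1 : z - a = (s * t)⁻¹ • ((p - a) - (s * (1 - t)) • (x - a)) := by
      rw [eq_inv_smul_iff₀ hst, hps]
      module
    have h2 : z - a ∈ (affineSpan ℝ (insert a (insert x K))).direction := by
      rw [h1]
      exact Submodule.smul_mem _ _ (sub_mem (AffineSubspace.vsub_mem_direction hp' ha')
        (Submodule.smul_mem _ _ (AffineSubspace.vsub_mem_direction hx' ha')))
    have := AffineSubspace.vadd_mem_of_mem_direction h2 ha'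
    simpa using this

theorem IsParallelohedralTiling.crossSum_eq_of_triangle (hT : IsParallelohedralTiling P T)
    (ha : IsGenericBase T a) {w : Set (E d) → V} (hw : IsBalanced T a w) {C : Set (E d)}
    (hC : C ∈ T) {x z : E d} (hx : x ∈ interior C) (hz : z ∈ interior C)
    (hxg : IsGenericFrom T a x) (hzg : IsGenericFrom T a z) (h : IsGenericTriangle T a x z) :
    crossSum T a w x = crossSum T a w z := by
  have hN := hT.tiling
  have hfac : ∀ {y : E d}, y ∈ interior C → ∀ F ∈ facets T, y ∉ F := fun hy F hF =>
    hN.notMem_facet_of_mem_interior hC hy hF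
  have hloc : ∀ y ∈ interior C, IsGenericFrom T a y →
      ∀ᶠ y' in 𝓝 y, crossSum T a w y' = crossSum T a w y := fun y hy hyg =>
    hT.eventually_crossSum_eq ha w (hfac hy) fun p hp =>
      hyg.notMem_skel_of_mem_segment ha.notMem_skel hp
  have h0 : x + (0 : ℝ) • (z - x) = x := by simp
  have h1 : x + (1 : ℝ) • (z - x) = z := by simp
  have hcont : Continuous fun t : ℝ => x + t • (z - x) := by fun_prop
  have key := eq_of_eventually_punctured_eq (h := fun t : ℝ => crossSum T a w (x + t • (z - x)))
    (fun t ht => ?_) ?_ ?_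
  · simpa only [h0, h1] using key
  · have hmem : x + t • (z - x) ∈ interior C :=
      (hN.polytope C hC).convex.interior.add_smul_sub_mem hx hz ht
    obtain ⟨c, hc⟩ := hT.exists_eventually_crossSum_eq ha hw (v := z - x) (hfac hmem)
      (fun p hp => h.notMem_skel ha.notMem_skel hxg hp) (fun K hK e₁ e₂ he h0 => by
        have hK2 := ridges_subset_lowFaces T hK
        refine h.notMem_sup K hK2
          (he.mem_sup_of_areaForm_eq_zero (hxg.sub_notMem_vectorSpan hK2) ?_)
        -- The area of the moving pair `x + t • (z - x) - a`, `z - x` is that of `x - a`, `z - a`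
        -- for all `t`, so one condition on the triangle gives transversality throughout.
        rw [add_sub_right_comm, areaForm_add_left, areaForm_smul_left, areaForm_self, mul_zero,
          add_zero, ← sub_sub_sub_cancel_right z x a, areaForm_sub_right, areaForm_self,
          sub_zero] at h0
        exact h0)
    refine ⟨c, ?_⟩
    have hsub : Tendsto (fun s : ℝ => s - t) (𝓝[≠] t) (𝓝[≠] 0) := by
      refine tendsto_nhdsWithin_of_tendsto_nhds_of_eventually_within _ ?_ ?_
      · have : ContinuousAt (fun s : ℝ => s - t) t := by fun_prop
        have h := this.tendsto
        rw [sub_self] at h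
        exact h.mono_left nhdsWithin_le_nhds
      · filter_upwards [self_mem_nhdsWithin] with s hs
        exact sub_ne_zero.2 hs
    filter_upwards [hsub.eventually hc] with s hs
    rw [add_assoc, ← add_smul, add_sub_cancel] at hs
    exact hs
  · have := hcont.continuousAt (x := 0)
    rw [ContinuousAt, h0] at this
    simpa only [h0] using this.eventually (hloc x hx hxg)
  · have := hcont.continuousAt (x := 1)
    rw [ContinuousAt, h1] at this
    simpa only [h1] using this.eventually (hloc z hz hzg)

theorem affineSpan_insert_insert_ne_top {K : Set (E d)} (hK : K ∈ lowFaces T 3) (a x : E d) :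
    affineSpan ℝ (insert a (insert x K)) ≠ ⊤ := by
  obtain ⟨C, hC, -, h⟩ := hK
  refine affineSpan_ne_top_of_finrank_lt ?_
  have h1 := finrank_vectorSpan_insert_le_set ℝ K x
  have h2 := finrank_vectorSpan_insert_le_set ℝ (insert x K) a
  rw [dim] at h
  omega

theorem mk'_span_sup_ne_top {K : Set (E d)} (hK : K ∈ lowFaces T 2) (a u : E d) :
    AffineSubspace.mk' a (Submodule.span ℝ {u} ⊔ vectorSpan ℝ K) ≠ ⊤ := by
  obtain ⟨C, hC, -, h⟩ := hK
  intro htop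
  have h1 := congrArg AffineSubspace.direction htop
  rw [AffineSubspace.direction_mk', AffineSubspace.direction_top] at h1
  have h2 := Submodule.finrank_add_le_finrank_add_finrank (Submodule.span ℝ {u}) (vectorSpan ℝ K)
  rw [h1, finrank_top, finrank_euclideanSpace_fin] at h2
  have h3 : Module.finrank ℝ (Submodule.span ℝ {u}) ≤ 1 := by
    simpa using finrank_span_le_card (R := ℝ) ({u} : Set (E d))
  rw [dim] at h
  omega

theorem IsParallelohedralTiling.exists_isGenericTriangle (hT : IsParallelohedralTiling P T)
    (a x y : E d) {U : Set (E d)} (hU : IsOpen U) (hne : U.Nonempty) :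
    ∃ z ∈ U, IsGenericFrom T a z ∧ IsGenericTriangle T a x z ∧ IsGenericTriangle T a y z := by
  let 𝒜 : Set (AffineSubspace ℝ (E d)) :=
    (fun K => affineSpan ℝ (insert a K)) '' lowFaces T 2 ∪
    ((fun K => affineSpan ℝ (insert a (insert x K))) '' lowFaces T 3 ∪
    ((fun K => affineSpan ℝ (insert a (insert y K))) '' lowFaces T 3 ∪
    ((fun K => AffineSubspace.mk' a (Submodule.span ℝ {x - a} ⊔ vectorSpan ℝ K)) '' lowFaces T 2 ∪
    (fun K => AffineSubspace.mk' a (Submodule.span ℝ {y - a} ⊔ vectorSpan ℝ K)) '' lowFaces T 2)))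
  have h2 := hT.countable_lowFaces 2
  have h3 := hT.countable_lowFaces 3
  have hc : 𝒜.Countable := (h2.image _).union ((h3.image _).union ((h3.image _).union
    ((h2.image _).union (h2.image _))))
  obtain ⟨z, hz, h⟩ := exists_mem_open_forall_notMem hU hne hc id (by
    rintro _ (⟨K, hK, rfl⟩ | ⟨K, hK, rfl⟩ | ⟨K, hK, rfl⟩ | ⟨K, hK, rfl⟩ | ⟨K, hK, rfl⟩)
    · exact affineSpan_insert_ne_top hK a
    · exact affineSpan_insert_insert_ne_top hK a x
    · exact affineSpan_insert_insert_ne_top hK a y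
    · exact mk'_span_sup_ne_top hK a _
    · exact mk'_span_sup_ne_top hK a _)
  refine ⟨z, hz, fun K hK => h _ (Or.inl ⟨K, hK, rfl⟩),
    ⟨fun K hK => h _ (Or.inr (Or.inl ⟨K, hK, rfl⟩)), fun K hK hmem => ?_⟩,
    ⟨fun K hK => h _ (Or.inr (Or.inr (Or.inl ⟨K, hK, rfl⟩))), fun K hK hmem => ?_⟩⟩
  · exact h _ (Or.inr (Or.inr (Or.inr (Or.inl ⟨K, hK, rfl⟩)))) (AffineSubspace.mem_mk'.2 hmem)
  · exact h _ (Or.inr (Or.inr (Or.inr (Or.inr ⟨K, hK, rfl⟩)))) (AffineSubspace.mem_mk'.2 hmem)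

/-- The crossing sum of balanced weights does not depend on the choice of a generic point in a
cell. -/
theorem IsParallelohedralTiling.crossSum_eq_of_mem_interior (hT : IsParallelohedralTiling P T)
    (ha : IsGenericBase T a) {w : Set (E d) → V} (hw : IsBalanced T a w) {C : Set (E d)}
    (hC : C ∈ T) {x y : E d} (hx : x ∈ interior C) (hy : y ∈ interior C)
    (hxg : IsGenericFrom T a x) (hyg : IsGenericFrom T a y) :
    crossSum T a w x = crossSum T a w y := by
  -- The triangle `a x y` need not be generic; a third point `z` makes both `a x z` and `a y z`
  -- generic.
  obtain ⟨z, hz, hzg, hxz, hyz⟩ := hT.exists_isGenericTriangle a x y isOpen_interior ⟨x, hx⟩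
  exact (hT.crossSum_eq_of_triangle ha hw hC hx hz hxg hzg hxz).trans
    (hT.crossSum_eq_of_triangle ha hw hC hy hz hyg hzg hyz).symm

/-- A generic point near a relative interior point of `F` is projected from `a` to the hyperplane of
`F`; moving along the ray from `a` keeps it generic. -/
theorem IsParallelohedralTiling.exists_isGenericFrom_mem_facet (hT : IsParallelohedralTiling P T)
    {F : Set (E d)} (hF : Convex ℝ F) (hne : F.Nonempty) {n : E d} (hn : IsNormalAwayFrom a F n) :
    ∃ z ∈ F, IsGenericFrom T a z := by
  obtain ⟨z, hz⟩ := exists_isRelInterior hF hne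
  have hzF := hz.mem
  obtain ⟨r, hr, hb⟩ := hz
  have hpos := hn.pos z hzF
  have hc := continuousAt_hitParam (p := z) hpos.ne'
  have h1 : hitParam a z n z = 1 := div_self hpos.ne'
  have hev1 : ∀ᶠ y in 𝓝 z, ‖a + hitParam a z n y • (y - a) - z‖ < r := by
    have hc2 : ContinuousAt (fun y => ‖a + hitParam a z n y • (y - a) - z‖) z := by fun_prop
    refine hc2.eventually_lt continuousAt_const ?_
    rw [h1, one_smul, add_sub_cancel, sub_self, norm_zero]
    exact hr
  have hev2 : ∀ᶠ y in 𝓝 z, hitParam a z n y ≠ 0 := hc.eventually_ne (by rw [h1]; exact one_ne_zero)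
  have hev3 : ∀ᶠ y in 𝓝 z, ⟪n, y - a⟫_ℝ ≠ 0 :=
    (show ContinuousAt (fun y => ⟪n, y - a⟫_ℝ) z by fun_prop).eventually_ne hpos.ne'
  obtain ⟨U, hU, hUo, hzU⟩ := mem_nhds_iff.1 (hev1.and (hev2.and hev3))
  obtain ⟨y, hyU, hy⟩ := hT.exists_isGenericFrom a hUo ⟨z, hzU⟩
  obtain ⟨hy1, hy2, hy3⟩ := hU hyU
  refine ⟨_, ?_, hy.lineMap hy2⟩
  have := hb _ (hn.hitPoint_sub_mem hy3) hy1
  rwa [add_sub_cancel] at this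

/-- On crossing a hyperface the crossing sum changes by the weight of this hyperface. -/
theorem IsParallelohedralTiling.exists_crossSum_jump {W : Type*} [AddCommGroup W]
    (hT : IsParallelohedralTiling P T) (w : Set (E d) → W) {C D : Set (E d)} (hC : C ∈ T) (hD : D ∈ T)
    (hadj : Adjacent C D) {n : E d} (hn : IsOuterNormal C (C ∩ D) n)
    (hna : IsNormalAwayFrom a (C ∩ D) n) :
    ∃ x ∈ interior C, ∃ y ∈ interior D, IsGenericFrom T a x ∧ IsGenericFrom T a y ∧
      crossSum T a w y = w (C ∩ D) + crossSum T a w x := by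
  have hN := hT.tiling
  obtain ⟨z, hzF, hzg⟩ := hT.exists_isGenericFrom_mem_facet
    (hadj.1.1.convex (hN.polytope C hC).convex) hadj.1.1.1 hna
  have hzs := hzg.notMem_skel
  have hFT : C ∩ D ∈ facets T := ⟨C, hC, hadj.1⟩
  obtain ⟨r, hr, hball⟩ := hN.exists_ball_of_adjacent hC hD hadj hn
    (hN.isRelInterior_of_mem_facets hFT hzF hzs)
  have hpos := hna.pos z hzF
  obtain ⟨ε, hε0, hε1, hεr⟩ : ∃ ε > 0, ε < 1 ∧ ε * ‖z - a‖ < r := by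
    obtain ⟨ε, hε0, hε⟩ := exists_between (lt_min one_pos (div_pos hr
      (by positivity : 0 < ‖z - a‖ + 1)))
    obtain ⟨h1, h2⟩ := lt_min_iff.1 hε
    rw [lt_div_iff₀ (by positivity)] at h2
    exact ⟨ε, hε0, h1, by nlinarith⟩
  have hnear : ∀ s : ℝ, |s - 1| ≤ ε → (s < 1 → a + s • (z - a) ∈ interior C) ∧
      (1 < s → a + s • (z - a) ∈ interior D) := by
    intro s hs
    have h1 : a + s • (z - a) - z = (s - 1) • (z - a) := by module
    have h2 : ‖a + s • (z - a) - z‖ < r := by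
      rw [h1, norm_smul, Real.norm_eq_abs]
      exact (mul_le_mul_of_nonneg_right hs (norm_nonneg _)).trans_lt hεr
    obtain ⟨h3, h4, -⟩ := hball _ h2
    rw [h1, real_inner_smul_right] at h3 h4
    exact ⟨fun h => h3 (mul_neg_of_neg_of_pos (by linarith) hpos),
      fun h => h4 (mul_pos (by linarith) hpos)⟩
  -- The points just before and just beyond the generic point `z` of the facet, on one ray from `a`.
  set x := a + (1 - ε) • (z - a) with hx
  set y := a + (1 + ε) • (z - a) with hy
  have hxC : x ∈ interior C := (hnear (1 - ε) (by simp [abs_of_pos hε0])).1 (by linarith)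
  have hyD : y ∈ interior D := (hnear (1 + ε) (by simp [abs_of_pos hε0])).2 (by linarith)
  have hseg : ∀ {c : ℝ}, 0 < c → ∀ q, q ∈ segment ℝ a (a + c • (z - a)) ↔
      ∃ s, 0 ≤ s ∧ s ≤ c ∧ q = a + s • (z - a) := by
    intro c hc q
    rw [mem_segment_iff_exists_add_smul]
    constructor
    · rintro ⟨t, h0, h1, rfl⟩
      exact ⟨t * c, by positivity, by nlinarith, by rw [add_sub_cancel_left, smul_smul]⟩
    · rintro ⟨s, h0, h1, rfl⟩
      refine ⟨s / c, by positivity, (div_le_one hc).2 h1, ?_⟩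
      rw [add_sub_cancel_left, smul_smul, div_mul_cancel₀ _ hc.ne']
  have hcell : ∀ B ∈ T, z ∈ B → B = C ∨ B = D := by
    intro B hB hzB
    rw [← (hN.polytope B hB).closure_interior] at hzB
    obtain ⟨b, hb1, hb2⟩ := mem_closure_iff.1 hzB _ Metric.isOpen_ball (Metric.mem_ball_self hr)
    obtain ⟨h1, h2, h3⟩ := hball b (by simpa [Metric.mem_ball, dist_eq_norm] using hb1)
    rcases lt_trichotomy ⟪n, b - z⟫_ℝ 0 with h0 | h0 | h0
    · exact Or.inl (hN.eq_of_mem_interior hB hC hb2 (interior_subset (h1 h0)))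
    · exact Or.inl (hN.eq_of_mem_interior hB hC hb2 (h3 h0).1)
    · exact Or.inr (hN.eq_of_mem_interior hB hD hb2 (interior_subset (h2 h0)))
  -- Extending the segment from `x` to `y` adds just one crossed facet: the added piece lies in the
  -- interiors of `C` and `D` except for `z`, and `C ∩ D` is the only facet through `z`.
  have hset : {F | F ∈ facets T ∧ (F ∩ segment ℝ a y).Nonempty} =
      insert (C ∩ D) {F | F ∈ facets T ∧ (F ∩ segment ℝ a x).Nonempty} := by
    ext F
    constructor
    · rintro ⟨hF, q, hqF, hq⟩
      obtain ⟨s, h0, h1, rfl⟩ := (hseg (by linarith) q).1 hq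
      by_cases hs : s ≤ 1 - ε
      · exact Or.inr ⟨hF, _, hqF, (hseg (by linarith) _).2 ⟨s, h0, hs, rfl⟩⟩
      · left
        push Not at hs
        have habs : |s - 1| ≤ ε := abs_le.2 ⟨by linarith, by linarith⟩
        rcases lt_trichotomy s 1 with h | rfl | h
        · exact absurd hqF (hN.notMem_facet_of_mem_interior hC ((hnear s habs).1 h) hF)
        · rw [one_smul, add_sub_cancel] at hqF
          obtain ⟨B, hB, hFB⟩ := hF
          rcases hcell B hB (hFB.1.subset hqF) with rfl | rfl
          · exact hFB.eq_of_mem hadj.1 hB hqF hzF hzs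
          · exact hFB.eq_of_mem hadj.2 hB hqF hzF hzs
        · exact absurd hqF (hN.notMem_facet_of_mem_interior hD ((hnear s habs).2 h) hF)
    · rintro (rfl | ⟨hF, q, hqF, hq⟩)
      · exact ⟨hFT, z, hzF, (hseg (by linarith) z).2 ⟨1, zero_le_one, by linarith, by simp⟩⟩
      · obtain ⟨s, h0, h1, rfl⟩ := (hseg (by linarith) q).1 hq
        exact ⟨hF, _, hqF, (hseg (by linarith) _).2 ⟨s, h0, by linarith, rfl⟩⟩
  have hnot : C ∩ D ∉ {F | F ∈ facets T ∧ (F ∩ segment ℝ a x).Nonempty} := by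
    rintro ⟨-, q, hqF, hq⟩
    obtain ⟨s, h0, h1, rfl⟩ := (hseg (by linarith) q).1 hq
    have h2 := hna.inner_sub_eq_zero hqF hzF
    have h3 : a + s • (z - a) - z = (s - 1) • (z - a) := by module
    rw [h3, real_inner_smul_right] at h2
    rcases mul_eq_zero.1 h2 with h | h
    · linarith
    · exact hpos.ne' h
  refine ⟨x, hxC, y, hyD, hzg.lineMap (by linarith), hzg.lineMap (by linarith), ?_⟩
  rw [crossSum, hset, finsum_mem_insert _ hnot]
  · rfl
  · refine hT.finite_facets_inter_nonempty ?_
    rw [segment_eq_image']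
    exact (isCompact_Icc.image (by fun_prop)).isBounded

/-- The potential of a cell is the crossing sum at an arbitrary generic point of it; independence of
this choice allows evaluation at the two points next to the facet. -/
theorem IsParallelohedralTiling.exists_potential (hT : IsParallelohedralTiling P T)
    (ha : IsGenericBase T a) {w : Set (E d) → V} (hw : IsBalanced T a w) :
    ∃ A : Set (E d) → V, ∀ C ∈ T, ∀ D ∈ T, Adjacent C D → ∀ n, IsOuterNormal C (C ∩ D) n →
      IsNormalAwayFrom a (C ∩ D) n → A D = w (C ∩ D) + A C := by
  have hpt : ∀ C, ∃ x, C ∈ T → x ∈ interior C ∧ IsGenericFrom T a x := fun C => by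
    by_cases hC : C ∈ T
    · obtain ⟨x, hx, hxg⟩ := hT.exists_isGenericFrom a isOpen_interior (hT.tiling.polytope C hC).2
      exact ⟨x, fun _ => ⟨hx, hxg⟩⟩
    · exact ⟨0, fun h => absurd h hC⟩
  choose x hx using hpt
  refine ⟨fun C => crossSum T a w (x C), fun C hC D hD hadj n hn hna => ?_⟩
  obtain ⟨y, hy, z, hz, hyg, hzg, h⟩ := hT.exists_crossSum_jump w hC hD hadj hn hna
  dsimp only
  rw [hT.crossSum_eq_of_mem_interior ha hw hD (hx D hD).1 hz (hx D hD).2 hzg, h,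
    hT.crossSum_eq_of_mem_interior ha hw hC (hx C hC).1 hy (hx C hC).2 hyg]

end Potential

/-! ### The piecewise linear function of a canonical scaling -/

section Scaling

variable {d : ℕ} {P : Set (E d)} {T : Set (Set (E d))} {a : E d}

theorem IsParallelohedralTiling.exists_isGenericBase (hT : IsParallelohedralTiling P T)
    {C : Set (E d)} (hC : C ∈ T) : ∃ a ∈ interior C, IsGenericBase T a := by
  obtain ⟨a, ha, h⟩ := exists_mem_open_forall_notMem isOpen_interior
    (hT.tiling.polytope C hC).2 ((hT.countable_lowFaces 1).mono (facets_subset_lowFaces T))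
    (fun F => affineSpan ℝ F) (by
      rintro F ⟨D, -, hF⟩
      refine affineSpan_ne_top_of_finrank_lt ?_
      have := hF.2
      rw [dim] at this
      omega)
  exact ⟨a, ha, h, hT.tiling.notMem_skel_of_mem_interior hC ha⟩

theorem sign_mul_pos_of_mul_pos {x y : ℝ} (h : 0 < x * y) : 0 < (SignType.sign x : ℝ) * y := by
  rcases lt_trichotomy x 0 with hx | rfl | hx
  · rw [sign_neg hx]
    have := neg_of_mul_pos_right h hx.le
    simpa using this
  · simp at h
  · rw [sign_pos hx]
    have := pos_of_mul_pos_right h hx.le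
    simpa using this

/-- The weights given by the jumps of the affine functions that correspond to a canonical
scaling are balanced. -/
theorem IsCanonicalScaling.isBalanced (hT : IsParallelohedralTiling P T) {s : Set (E d) → ℝ}
    (hs : IsCanonicalScaling T s) {ν ζ : Set (E d) → E d}
    (hν : ∀ F ∈ facets T, IsNormalAwayFrom a F (ν F)) (hζ : ∀ F ∈ facets T, ζ F ∈ F) :
    IsBalanced T a fun F => s F • ((ν F, -⟪ν F, ζ F⟫_ℝ) : E d × ℝ) := by
  intro K hK e₁ e₂ he η hη
  obtain ⟨p, hpK⟩ : K.Nonempty := by obtain ⟨C, -, hC⟩ := hK; exact hC.1.1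
  have hfin : (facetsContaining T K).Finite :=
    (hT.finite_facets_inter_nonempty (Bornology.isBounded_singleton (x := p))).subset
      fun F hF => ⟨hF.1, p, hF.2 hpK, rfl⟩
  -- Correcting the normals pointing away from `a` by the signs of `η` makes them coherent, so the
  -- torsion is the signed sum of the weights.
  have hcoh : AreCoherentNormals T K e₁ e₂ fun F => (SignType.sign (η F) : ℝ) • ν F := by
    intro F hF
    obtain ⟨h0, h1⟩ := hη F hF
    refine ⟨⟨?_, fun v hv => ?_⟩, fun g hg x hx => ?_⟩
    · rw [norm_smul, (hν F hF.1).norm, mul_one]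
      rcases h0.lt_or_gt with h | h
      · simp [sign_neg h]
      · simp [sign_pos h]
    · rw [real_inner_smul_left, ((hν F hF.1).mem_iff v).1 hv, mul_zero]
    · have := sign_mul_pos_of_mul_pos (h1 _ (hν F hF.1) g hg x hx)
      rwa [← areaForm_smul_right] at this
  have htor := hs.torsion_eq_zero K hK e₁ e₂ he _ hcoh
  rw [torsion, finsum_mem_eq_finite_toFinset_sum _ hfin] at htor
  rw [finsum_mem_eq_finite_toFinset_sum _ hfin]
  have h1 : ∑ F ∈ hfin.toFinset, (SignType.sign (η F) : ℝ) • s F • ν F = 0 := by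
    rw [← htor]
    exact Finset.sum_congr rfl fun F _ => smul_comm _ _ _
  -- All these facets contain `p`, so `ζ F` may be replaced by `p`, and the constant terms balance
  -- by pairing the gradient identity with `-p`.
  have h2 : ∑ F ∈ hfin.toFinset, (SignType.sign (η F) : ℝ) • s F • (-⟪ν F, ζ F⟫_ℝ) = 0 := by
    have h3 := congrArg (fun v => ⟪v, -p⟫_ℝ) h1
    simp only [sum_inner, inner_zero_left] at h3
    rw [← h3]
    refine Finset.sum_congr rfl fun F hF => ?_
    obtain ⟨hFT, hKF⟩ := hfin.mem_toFinset.1 hF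
    have h4 := (hν F hFT).inner_sub_eq_zero (hζ F hFT) (hKF hpK)
    rw [inner_sub_right, sub_eq_zero] at h4
    rw [h4, real_inner_smul_left, real_inner_smul_left, inner_neg_right]
    simp only [smul_eq_mul]
  refine Prod.ext ?_ ?_
  · rw [Prod.fst_sum]; exact h1
  · rw [Prod.snd_sum]; exact h2

/-- A canonical scaling is the scaling of jumps of the gradients `g` of a piecewise affine function,
which is equal to `⟪g C, x⟫ + h C` on the cell `C`. -/
theorem IsCanonicalScaling.exists_gradient (hT : IsParallelohedralTiling P T) {s : Set (E d) → ℝ}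
    (hs : IsCanonicalScaling T s) (hne : T.Nonempty) :
    ∃ (g : Set (E d) → E d) (h : Set (E d) → ℝ), ∀ C ∈ T, ∀ D ∈ T, Adjacent C D →
      ∀ n, IsOuterNormal C (C ∩ D) n → ∀ z ∈ C ∩ D,
        g D = g C + s (C ∩ D) • n ∧ h D = h C - s (C ∩ D) * ⟪n, z⟫_ℝ := by
  obtain ⟨C₀, hC₀⟩ := hne
  obtain ⟨a, -, ha⟩ := hT.exists_isGenericBase hC₀
  have hN := hT.tiling
  have hν : ∀ F, ∃ ν ζ : E d, F ∈ facets T → IsNormalAwayFrom a F ν ∧ ζ ∈ F := fun F => by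
    by_cases hF : F ∈ facets T
    · obtain ⟨n, hn⟩ := hN.exists_isNormalAwayFrom hF (ha.notMem_affineSpan F hF)
      obtain ⟨C, -, hFC⟩ := hF
      obtain ⟨z, hz⟩ := hFC.1.1
      exact ⟨n, z, fun _ => ⟨hn, hz⟩⟩
    · exact ⟨0, 0, fun h => absurd h hF⟩
  choose ν ζ hν using hν
  obtain ⟨A, hA⟩ := hT.exists_potential ha
    (hs.isBalanced hT (fun F hF => (hν F hF).1) fun F hF => (hν F hF).2)
  have key : ∀ C ∈ T, ∀ D ∈ T, Adjacent C D → ∀ n, IsOuterNormal C (C ∩ D) n →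
      IsNormalAwayFrom a (C ∩ D) n → ∀ z ∈ C ∩ D, (A D).1 = (A C).1 + s (C ∩ D) • n ∧
        (A D).2 = (A C).2 - s (C ∩ D) * ⟪n, z⟫_ℝ := by
    intro C hC D hD hadj n hn hna z hz
    have h1 := hA C hC D hD hadj n hn hna
    obtain ⟨h2, h3⟩ := hν (C ∩ D) ⟨C, hC, hadj.1⟩
    have h4 := h2.unique hna ⟨z, hz⟩
    have h5 := hna.inner_sub_eq_zero h3 hz
    rw [inner_sub_right, sub_eq_zero] at h5
    rw [h1, h4]
    refine ⟨by simp [add_comm], ?_⟩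
    simp [h5]
    ring
  refine ⟨fun C => (A C).1, fun C => (A C).2, fun C hC D hD hadj n hn z hz => ?_⟩
  -- If `n` points towards `a`, the relation is read from `D` to `C` with `-n`.
  rcases (hn.inner_sub_ne_zero (ha.notMem_affineSpan _ ⟨C, hC, hadj.1⟩) hz).lt_or_gt with h | h
  · have hn' := hN.isOuterNormal_neg hC hD hadj hn
    have hna := hn.isNormalAwayFrom_neg hz h
    rw [Set.inter_comm] at hn' hna hz
    obtain ⟨h1, h2⟩ := key D hD C hC hadj.symm (-n) hn' hna z hz
    rw [Set.inter_comm C D]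
    dsimp only
    rw [h1, h2, inner_neg_left]
    exact ⟨by simp, by ring⟩
  · exact key C hC D hD hadj n hn (hn.isNormalAwayFrom hz h) z hz

end Scaling

/-! ### Translations of the tiling -/

section Translation

variable {d : ℕ} {P : Set (E d)} {T : Set (Set (E d))}

theorem IsFace.vadd {C F : Set (E d)} (h : IsFace C F) (t : E d) : IsFace (t +ᵥ C) (t +ᵥ F) := by
  refine ⟨h.1.vadd_set, fun _ => ?_⟩
  obtain ⟨l, hl⟩ := h.2 h.1
  refine ⟨l, ?_⟩
  ext x
  constructor
  · rintro ⟨y, hy, rfl⟩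
    rw [hl] at hy
    refine ⟨⟨y, hy.1, rfl⟩, ?_⟩
    rintro _ ⟨z, hz, rfl⟩
    have := hy.2 z hz
    simpa using this
  · rintro ⟨⟨y, hy, rfl⟩, hmax⟩
    refine ⟨y, ?_, rfl⟩
    rw [hl]
    refine ⟨hy, fun z hz => ?_⟩
    have := hmax (t +ᵥ z) ⟨z, hz, rfl⟩
    simpa using this

theorem dim_vadd (F : Set (E d)) (t : E d) : dim (t +ᵥ F) = dim F := by
  rw [dim, dim, vectorSpan_vadd]

theorem IsFacet.vadd {C F : Set (E d)} (h : IsFacet C F) (t : E d) :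
    IsFacet (t +ᵥ C) (t +ᵥ F) :=
  ⟨h.1.vadd t, by rw [dim_vadd]; exact h.2⟩

theorem Adjacent.vadd {C D : Set (E d)} (h : Adjacent C D) (t : E d) :
    Adjacent (t +ᵥ C) (t +ᵥ D) := by
  unfold Adjacent
  rw [← Set.vadd_set_inter]
  exact ⟨h.1.vadd t, h.2.vadd t⟩

theorem IsOuterNormal.vadd {C F : Set (E d)} {n : E d} (h : IsOuterNormal C F n) (t : E d) :
    IsOuterNormal (t +ᵥ C) (t +ᵥ F) n := by
  refine ⟨h.norm, fun v => by rw [vectorSpan_vadd]; exact h.mem_iff v, ?_, ?_⟩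
  · rintro _ ⟨z, hz, rfl⟩ _ ⟨y, hy, rfl⟩
    have := h.nonpos z hz y hy
    simpa using this
  · rintro _ ⟨z, hz, rfl⟩ _ ⟨y, hy, rfl⟩ h0
    exact ⟨y, h.mem_of_eq z hz y hy (by simpa using h0), rfl⟩

/-- A bounded nonempty closed set is not mapped to itself by a nonzero translation. -/
theorem eq_of_vadd_eq_vadd {F : Set (E d)} (hF : IsCompact F) (hne : F.Nonempty) {t u : E d}
    (h : t +ᵥ F = u +ᵥ F) : t = u := by
  obtain ⟨f, hf, hmax⟩ := hF.exists_isMaxOn hne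
    (f := fun x => ⟪t - u, x⟫_ℝ) (by fun_prop)
  obtain ⟨f', hf', hff'⟩ : t +ᵥ f ∈ u +ᵥ F := h ▸ Set.vadd_mem_vadd_set hf
  have h1 : f' = f + (t - u) := by
    simp only [vadd_eq_add] at hff'
    rw [← sub_eq_zero] at hff' ⊢
    rw [← hff']
    abel
  have h2 : ⟪t - u, f'⟫_ℝ ≤ ⟪t - u, f⟫_ℝ := hmax hf'
  rw [h1, inner_add_right, add_le_iff_nonpos_right, real_inner_self_nonpos, sub_eq_zero] at h2
  exact h2

theorem IsParallelohedralTiling.exists_mem_facet_notMem_skel (hT : IsParallelohedralTiling P T)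
    {C F : Set (E d)} (hC : C ∈ T) (hF : IsFacet C F) : ∃ z ∈ F, z ∉ skel T 2 := by
  have hCp := hT.tiling.polytope C hC
  obtain ⟨n, hn⟩ := hF.exists_isOuterNormal hCp
  obtain ⟨z, hz⟩ := hF.1.1
  obtain ⟨x, hx, hxg⟩ := hT.exists_isGenericFrom_mem_facet (hF.1.convex hCp.convex) hF.1.1
    -- Any base point behind the facet would do; `z - n` makes the inner product equal to one.
    (hn.isNormalAwayFrom (a := z - n) hz
      (by rw [sub_sub_cancel, hn.inner_self]; exact one_pos))
  exact ⟨x, hx, hxg.notMem_skel⟩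

/-- The position of a neighbour of a cell is determined by the common hyperface. -/
theorem IsParallelohedralTiling.vadd_mem_of_adjacent (hT : IsParallelohedralTiling P T)
    {C D : Set (E d)} (hC : C ∈ T) (hD : D ∈ T) (hadj : Adjacent C D) {t : E d}
    (ht : t +ᵥ C ∈ T) : t +ᵥ D ∈ T := by
  have hN := hT.tiling
  obtain ⟨n, hn⟩ := hadj.1.exists_isOuterNormal (hN.polytope C hC)
  have hF' := hadj.1.vadd t
  obtain ⟨z, hz, hzs⟩ := hT.exists_mem_facet_notMem_skel ht hF'
  obtain ⟨D', hD', -, hinter, hadj'⟩ := hT.exists_adjacent ht hF' hz hzs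
  -- The cell across the translated facet is `u +ᵥ D` for some `u`; the aim is `u = t`.
  obtain ⟨u, rfl⟩ := hT.exists_vadd_eq hD hD'
  have h1 : IsOuterNormal (u +ᵥ D) (t +ᵥ (C ∩ D)) (-n) := by
    have := hN.isOuterNormal_neg ht hD' hadj' (n := n) (by rw [hinter]; exact hn.vadd t)
    rwa [hinter] at this
  have h2 : IsOuterNormal (u +ᵥ D) (u +ᵥ (C ∩ D)) (-n) :=
    (hN.isOuterNormal_neg hC hD hadj hn).vadd u
  have hs1 : t +ᵥ (C ∩ D) ⊆ u +ᵥ D := hinter ▸ Set.inter_subset_right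
  have hs2 : u +ᵥ (C ∩ D) ⊆ u +ᵥ D := Set.vadd_set_mono Set.inter_subset_right
  -- `t +ᵥ (C ∩ D)` and `u +ᵥ (C ∩ D)` both carry the outer normal `-n` of the same cell, so they
  -- lie in one supporting hyperplane and coincide.
  have hzero : ∀ y ∈ u +ᵥ (C ∩ D), ∀ x ∈ t +ᵥ (C ∩ D), ⟪-n, y - x⟫_ℝ = 0 := by
    intro y hy x hx
    have e1 := h1.nonpos x hx y (hs2 hy)
    have e2 := h2.nonpos y hy x (hs1 hx)
    rw [← neg_sub, inner_neg_right] at e2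
    linarith
  obtain ⟨y₀, hy₀⟩ : (u +ᵥ (C ∩ D)).Nonempty := hadj.1.1.1.vadd_set
  have heq : t +ᵥ (C ∩ D) = u +ᵥ (C ∩ D) := by
    refine Set.Subset.antisymm (fun x hx => ?_) fun y hy => ?_
    · refine h2.mem_of_eq y₀ hy₀ x (hs1 hx) ?_
      rw [← neg_sub, inner_neg_right, hzero y₀ hy₀ x hx, neg_zero]
    · exact h1.mem_of_eq z hz y (hs2 hy) (hzero y hy z hz)
  rw [eq_of_vadd_eq_vadd (hadj.1.1.isCompact (hN.polytope C hC)) hadj.1.1.1 heq]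
  exact hD'

theorem IsParallelohedralTiling.vadd_mem (hT : IsParallelohedralTiling P T) {C D : Set (E d)}
    (hC : C ∈ T) (hD : D ∈ T) {t : E d} (ht : t +ᵥ C ∈ T) : t +ᵥ D ∈ T := by
  have h := hT.reflTransGen_adjacent hC hD
  clear hD
  induction h with
  | refl => exact ht
  | tail _ h ih => exact hT.vadd_mem_of_adjacent h.1 h.2.1 h.2.2 ih

theorem IsParallelohedralTiling.vadd_image_eq (hT : IsParallelohedralTiling P T) {C : Set (E d)}
    (hC : C ∈ T) {t : E d} (ht : t +ᵥ C ∈ T) : (fun D : Set (E d) => t +ᵥ D) '' T = T := by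
  refine Set.Subset.antisymm ?_ fun D hD => ⟨-t +ᵥ D, ?_, vadd_neg_vadd t D⟩
  · rintro _ ⟨D, hD, rfl⟩
    exact hT.vadd_mem hC hD ht
  · exact hT.vadd_mem ht hD (by rwa [neg_vadd_vadd])

/-- If `v` were a nonzero vector orthogonal to all these translations, every cell would have the
same bounded extent in the direction `v`, and the cells could not cover the space. -/
theorem IsParallelohedralTiling.span_translations_eq_top (hT : IsParallelohedralTiling P T)
    {C : Set (E d)} (hC : C ∈ T) : Submodule.span ℝ {t : E d | t +ᵥ C ∈ T} = ⊤ := by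
  rw [← Submodule.orthogonal_eq_bot_iff, Submodule.eq_bot_iff]
  intro v hv
  by_contra hv0
  obtain ⟨R, hR⟩ := (hT.tiling.polytope C hC).isCompact.isBounded.subset_closedBall 0
  have hpos : 0 < ‖v‖ := norm_pos_iff.2 hv0
  obtain ⟨D, hD, hxD⟩ : ((R + 1) / ‖v‖) • v ∈ ⋃₀ T := by rw [hT.tiling.cover]; trivial
  obtain ⟨t, rfl⟩ := hT.exists_vadd_eq hC hD
  obtain ⟨x, hx, hxv⟩ := hxD
  have h1 : ⟪v, t⟫_ℝ = 0 := by
    rw [real_inner_comm]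
    exact Submodule.inner_right_of_mem_orthogonal (Submodule.subset_span hD) hv
  have h2 := congrArg (fun y => ⟪v, y⟫_ℝ) hxv
  simp only [vadd_eq_add, inner_add_right, real_inner_smul_right, h1, zero_add,
    real_inner_self_eq_norm_sq] at h2
  have h3 := real_inner_le_norm v x
  have h4 : ‖x‖ ≤ R := by simpa using hR hx
  have h5 : (R + 1) / ‖v‖ * ‖v‖ ^ 2 = (R + 1) * ‖v‖ := by field_simp
  rw [h2, h5] at h3
  nlinarith

/-- A vector orthogonal to all the normals of the hyperfaces of a cell is zero. -/
theorem IsParallelohedralTiling.eq_zero_of_forall_inner_eq_zero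
    (hT : IsParallelohedralTiling P T) {C : Set (E d)} (hC : C ∈ T) {v : E d}
    (hv : ∀ D ∈ T, Adjacent C D → ∀ n, IsOuterNormal C (C ∩ D) n → ⟪n, v⟫_ℝ = 0) : v = 0 := by
  by_contra hv0
  have hN := hT.tiling
  have hCp := hN.polytope C hC
  obtain ⟨a, ha⟩ := hCp.2
  obtain ⟨δ, hδ, hball⟩ := Metric.isOpen_iff.1 isOpen_interior a ha
  obtain ⟨R, hR⟩ := hCp.isCompact.isBounded.subset_closedBall a
  have hpos : 0 < ‖v‖ := norm_pos_iff.2 hv0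
  -- Far enough in the direction `v` to be outside `C`; a generic `b` within `δ / 2` of it replaces
  -- it. The segment from `a` to `b` leaves `C` through a facet whose normal is orthogonal to `v`.
  set b₀ := a + ((|R| + 1) / ‖v‖) • v with hb₀
  have hb₀C : b₀ ∉ C := by
    intro h
    have h1 := hR h
    rw [mem_closedBall_iff_norm, hb₀, add_sub_cancel_left, norm_smul, norm_div, norm_norm,
      div_mul_cancel₀ _ hpos.ne', Real.norm_of_nonneg (by positivity)] at h1
    linarith [le_abs_self R]
  obtain ⟨b, ⟨hbC, hbb⟩, hbg⟩ := hT.exists_isGenericFrom a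
    (hCp.isClosed.isOpen_compl.inter (Metric.isOpen_ball (x := b₀) (ε := δ / 2)))
    ⟨b₀, hb₀C, Metric.mem_ball_self (by positivity)⟩
  obtain ⟨p, hp, hpf⟩ : ∃ p ∈ segment ℝ a b, p ∈ C ∧ p ∉ interior C := by
    by_contra! hcon
    have hsub := (convex_segment a b).isPreconnected.subset_of_closure_inter_subset
      isOpen_interior ⟨a, left_mem_segment ℝ a b, ha⟩ fun x hx => hcon x hx.2
        (closure_minimal interior_subset hCp.isClosed hx.1)
    exact hbC (interior_subset (hsub (right_mem_segment ℝ a b)))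
  have hps := hbg.notMem_skel_of_mem_segment (hN.notMem_skel_of_mem_interior hC ha) hp
  obtain ⟨F, hF, hpF⟩ := hT.exists_facet hC hpf.1 hpf.2 hps
  obtain ⟨D, hD, -, rfl, hadj⟩ := hT.exists_adjacent hC hF hpF hps
  obtain ⟨n, hn⟩ := hF.exists_isOuterNormal hCp
  have hnv := hv D hD hadj n hn
  have h1 : a + (δ / 2) • n ∈ C := by
    refine interior_subset (hball ?_)
    rw [mem_ball_iff_norm, add_sub_cancel_left, norm_smul, hn.norm, mul_one,
      Real.norm_of_nonneg (by positivity)]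
    linarith
  have h2 := hn.nonpos p hpF _ h1
  obtain ⟨t, h0, h1', rfl⟩ := mem_segment_iff_exists_add_smul.1 hp
  have h3 : a + (δ / 2) • n - (a + t • (b - a)) = (δ / 2) • n - t • (b - a) := by abel
  rw [h3, inner_sub_right, real_inner_smul_right, hn.inner_self, real_inner_smul_right] at h2
  have h4 : b - a = (b - b₀) + ((|R| + 1) / ‖v‖) • v := by rw [hb₀]; abel
  rw [h4, inner_add_right, real_inner_smul_right, hnv, mul_zero, add_zero] at h2
  have h5 := real_inner_le_norm n (b - b₀)
  rw [hn.norm, one_mul] at h5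
  have h6 : ‖b - b₀‖ < δ / 2 := by rwa [mem_ball_iff_norm] at hbb
  -- Since `⟪n, v⟫ = 0`, the segment rises above `a` along `n` by less than `δ / 2`, while `C`
  -- contains `a + (δ / 2) • n`. So it cannot have reached the facet.
  nlinarith [norm_nonneg (b - b₀), mul_le_mul_of_nonneg_left h5 h0]

/-- The gradients change by the same vector, and the constant terms in the corresponding way, when a
cell is translated by a vector that preserves the tiling. -/
theorem IsParallelohedralTiling.exists_quasiperiod (hT : IsParallelohedralTiling P T)
    {s : Set (E d) → ℝ} (hinv : IsTranslationInvariant T s) {g : Set (E d) → E d}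
    {h : Set (E d) → ℝ}
    (hgh : ∀ C ∈ T, ∀ D ∈ T, Adjacent C D → ∀ n, IsOuterNormal C (C ∩ D) n → ∀ z ∈ C ∩ D,
      g D = g C + s (C ∩ D) • n ∧ h D = h C - s (C ∩ D) * ⟪n, z⟫_ℝ)
    {C₀ : Set (E d)} (hC₀ : C₀ ∈ T) {t : E d} (ht : t +ᵥ C₀ ∈ T) :
    ∃ (q : E d) (b : ℝ), ∀ C ∈ T, g (t +ᵥ C) = g C + q ∧ h (t +ᵥ C) = h C - ⟪g C, t⟫_ℝ + b := by
  refine ⟨g (t +ᵥ C₀) - g C₀, h (t +ᵥ C₀) - h C₀ + ⟪g C₀, t⟫_ℝ, fun C hC => ?_⟩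
  have hpath := hT.reflTransGen_adjacent hC₀ hC
  clear hC
  induction hpath with
  | refl => exact ⟨by abel, by ring⟩
  | @tail C D _ hCD ih =>
    obtain ⟨hC, hD, hadj⟩ := hCD
    obtain ⟨n, hn⟩ := hadj.1.exists_isOuterNormal (hT.tiling.polytope C hC)
    obtain ⟨z, hz⟩ := hadj.1.1.1
    obtain ⟨e1, e2⟩ := hgh C hC D hD hadj n hn z hz
    obtain ⟨e3, e4⟩ := hgh _ (hT.vadd_mem hC₀ hC ht) _ (hT.vadd_mem hC₀ hD ht) (hadj.vadd t) n
      (by rw [← Set.vadd_set_inter]; exact hn.vadd t) (t +ᵥ z)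
      (by rw [← Set.vadd_set_inter]; exact Set.vadd_mem_vadd_set hz)
    rw [← Set.vadd_set_inter, hinv t (hT.vadd_image_eq hC₀ ht) _ ⟨C, hC, hadj.1⟩] at e3 e4
    rw [e3, e4, e1, e2, ih.1, ih.2, vadd_eq_add, inner_add_right, inner_add_left,
      real_inner_smul_left]
    exact ⟨by abel, by ring⟩

/-- The increments of the gradients under the translations are given by a symmetric linear map. -/
theorem IsParallelohedralTiling.exists_isSymmetric (hT : IsParallelohedralTiling P T)
    {s : Set (E d) → ℝ} (hs : IsCanonicalScaling T s) (hinv : IsTranslationInvariant T s)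
    {C₀ : Set (E d)} (hC₀ : C₀ ∈ T) :
    ∃ L : E d →ₗ[ℝ] E d, L.IsSymmetric ∧ ∀ t : E d, t +ᵥ C₀ ∈ T → Adjacent C₀ (t +ᵥ C₀) →
      ∀ n, IsOuterNormal C₀ (C₀ ∩ (t +ᵥ C₀)) n → L t = s (C₀ ∩ (t +ᵥ C₀)) • n := by
  obtain ⟨g, h, hgh⟩ := hs.exists_gradient hT ⟨C₀, hC₀⟩
  have hq : ∀ t : E d, ∃ (q : E d) (b : ℝ), t +ᵥ C₀ ∈ T →
      ∀ C ∈ T, g (t +ᵥ C) = g C + q ∧ h (t +ᵥ C) = h C - ⟪g C, t⟫_ℝ + b := fun t => by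
    by_cases ht : t +ᵥ C₀ ∈ T
    · obtain ⟨q, b, hqb⟩ := hT.exists_quasiperiod hinv hgh hC₀ ht
      exact ⟨q, b, fun _ => hqb⟩
    · exact ⟨0, 0, fun h => absurd h ht⟩
  choose q b hq using hq
  -- Expanding the constant term of the cell `t + u + C₀` in the two orders leaves only these mixed
  -- terms.
  have hsymm : ∀ t u : E d, t +ᵥ C₀ ∈ T → u +ᵥ C₀ ∈ T → ⟪q t, u⟫_ℝ = ⟪q u, t⟫_ℝ := by
    intro t u ht hu
    have h1 := (hq t ht _ hu).2
    have h2 := (hq u hu _ ht).2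
    rw [vadd_comm t u C₀, h2, (hq t ht C₀ hC₀).1, (hq t ht C₀ hC₀).2, (hq u hu C₀ hC₀).1,
      (hq u hu C₀ hC₀).2, inner_add_left, inner_add_left] at h1
    linarith
  have hspan := hT.span_translations_eq_top hC₀
  let B := Module.Basis.ofSpan hspan.ge
  have hB : ∀ i, B i +ᵥ C₀ ∈ T := fun i =>
    Module.Basis.ofSpan_subset hspan.ge (Set.mem_range_self i)
  let L : E d →ₗ[ℝ] E d := B.constr ℝ fun i => q (B i)
  have hLB : ∀ i, L (B i) = q (B i) := fun i => B.constr_basis ℝ _ i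
  have hL : ∀ i x, ⟪L x, B i⟫_ℝ = ⟪x, q (B i)⟫_ℝ := by
    intro i x
    have : (innerₛₗ ℝ (B i)).comp L = innerₛₗ ℝ (q (B i)) := by
      refine B.ext fun j => ?_
      simp only [LinearMap.comp_apply, innerₛₗ_apply_apply, hLB]
      rw [real_inner_comm, hsymm _ _ (hB j) (hB i)]
    have h1 := LinearMap.congr_fun this x
    simp only [LinearMap.comp_apply, innerₛₗ_apply_apply] at h1
    rw [real_inner_comm, h1, real_inner_comm]
  -- Additivity of `q` is not proved beforehand: `L t` and `q t` have equal inner products with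
  -- every basis translation, by the symmetry relation.
  have hLq : ∀ t, t +ᵥ C₀ ∈ T → L t = q t := fun t ht => by
    refine InnerProductSpace.ext_inner_right_basis B fun i => ?_
    rw [hL, hsymm t _ ht (hB i), real_inner_comm]
  refine ⟨L, fun x y => ?_, fun t ht hadj n hn => ?_⟩
  · have : innerₛₗ ℝ (L x) = (innerₛₗ ℝ x).comp L := by
      refine B.ext fun j => ?_
      simp only [LinearMap.comp_apply, innerₛₗ_apply_apply, hLB, hL]
    exact LinearMap.congr_fun this y
  · obtain ⟨z, hz⟩ := hadj.1.1.1
    have h1 := (hgh C₀ hC₀ _ ht hadj n hn z hz).1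
    rw [hLq t ht]
    rw [(hq t ht C₀ hC₀).1] at h1
    exact add_left_cancel h1

end Translation

end Parallelohedra

/-! ### Passage to matrices and the main theorem -/

theorem Parallelohedra.vecMul_columnMatrix {d k : ℕ} (u : Fin d → ℝ)
    (v : Fin k → Parallelohedra.E d) (i : Fin k) :
    Matrix.vecMul u (Parallelohedra.columnMatrix v) i = ⟪v i, WithLp.toLp 2 u⟫_ℝ := by
  simp [Matrix.vecMul, dotProduct, Parallelohedra.columnMatrix, PiLp.inner_apply]

theorem Parallelohedra.columnMatrix_eq_mul {d k : ℕ}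
    (L : Parallelohedra.E d →ₗ[ℝ] Parallelohedra.E d) (p m : Fin k → Parallelohedra.E d)
    (h : ∀ i, L (p i) = m i) :
    Parallelohedra.columnMatrix m =
      LinearMap.toMatrix (EuclideanSpace.basisFun (Fin d) ℝ).toBasis
        (EuclideanSpace.basisFun (Fin d) ℝ).toBasis L * Parallelohedra.columnMatrix p := by
  ext a i
  have h1 := congrFun (LinearMap.toMatrix_mulVec_repr
    (EuclideanSpace.basisFun (Fin d) ℝ).toBasis (EuclideanSpace.basisFun (Fin d) ℝ).toBasis L
    (p i)) a
  rw [h i] at h1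
  simp only [Matrix.mulVec, dotProduct, OrthonormalBasis.coe_toBasis_repr_apply,
    EuclideanSpace.basisFun_repr] at h1
  rw [Matrix.mul_apply]
  exact h1.symm

theorem mainTheorem8 {d : ℕ} (P : Set (Parallelohedra.E d)) (T : Set (Set (Parallelohedra.E d)))
    (hT : Parallelohedra.IsParallelohedralTiling P T)
    (s : Set (Parallelohedra.E d) → ℝ)
    (hs : Parallelohedra.IsCanonicalScaling T s)
    (hinv : Parallelohedra.IsTranslationInvariant T s)
    (P₀ : Set (Parallelohedra.E d)) (hP₀ : P₀ ∈ T)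
    (k : ℕ) (C : Fin k → Set (Parallelohedra.E d)) (hCinj : Function.Injective C)
    (hC : Set.range C = {C' | C' ∈ T ∧ Parallelohedra.Adjacent P₀ C'})
    (n : Fin k → Parallelohedra.E d)
    (hn : ∀ i, Parallelohedra.IsUnitNormalFromTo P₀ (C i) (n i))
    (p m : Fin k → Parallelohedra.E d)
    (hp : ∀ i, p i = Parallelohedra.cellCenter (C i) - Parallelohedra.cellCenter P₀)
    (hm : ∀ i, m i = s (P₀ ∩ C i) • n i) :
    ∃! Q : Matrix (Fin d) (Fin d) ℝ,
      Q.IsSymm ∧ Q.det ≠ 0 ∧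
        Parallelohedra.columnMatrix m = Q * Parallelohedra.columnMatrix p := by
  have hP := hT.tiling.polytope P₀ hP₀
  have hCi : ∀ i, C i ∈ T ∧ Parallelohedra.Adjacent P₀ (C i) := fun i => by
    have : C i ∈ Set.range C := Set.mem_range_self i
    rwa [hC] at this
  have hni : ∀ i, Parallelohedra.IsOuterNormal P₀ (P₀ ∩ C i) (n i) := fun i =>
    (hn i).isOuterNormal hP (hCi i).2
  -- The centroid moves with the cell, so the difference of centers is the translation vector;
  -- central symmetry is not needed.
  have hpi : ∀ i, C i = p i +ᵥ P₀ := fun i => by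
    obtain ⟨t, ht⟩ := hT.exists_vadd_eq hP₀ (hCi i).1
    rw [hp i, ht, Parallelohedra.cellCenter_vadd hP, add_sub_cancel_right]
  obtain ⟨L, hLs, hL⟩ := hT.exists_isSymmetric hs hinv hP₀
  have hLp : ∀ i, L (p i) = m i := fun i => by
    have h1 := hCi i
    have h2 := hni i
    rw [hm i]
    rw [hpi i] at h1 h2 ⊢
    exact hL (p i) h1.1 h1.2 (n i) h2
  set b := EuclideanSpace.basisFun (Fin d) ℝ with hb
  set Q := LinearMap.toMatrix b.toBasis b.toBasis L with hQ
  have hM := Parallelohedra.columnMatrix_eq_mul L p m hLp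
  rw [← hb, ← hQ] at hM
  -- The rows of `M` are independent: a vector annihilating all columns is orthogonal to every facet
  -- normal of `P₀`, as the scaling factors are nonzero.
  have hker : ∀ u : Fin d → ℝ,
      Matrix.vecMul u (Parallelohedra.columnMatrix m) = 0 → u = 0 := by
    intro u hu
    have h0 : WithLp.toLp 2 u = (0 : Parallelohedra.E d) := by
      refine hT.eq_zero_of_forall_inner_eq_zero hP₀ fun D hD hadj ν hν => ?_
      obtain ⟨i, rfl⟩ : D ∈ Set.range C := by rw [hC]; exact ⟨hD, hadj⟩
      have h1 := congrFun hu i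
      rw [Parallelohedra.vecMul_columnMatrix, hm i, real_inner_smul_left] at h1
      have h2 := (mul_eq_zero.1 h1).resolve_left (hs.pos _ ⟨P₀, hP₀, hadj.1⟩).ne'
      rcases (hni i).eq_or_eq_neg hν.isUnitNormal with h | h
      · rw [h, h2]
      · rw [h, inner_neg_left, h2, neg_zero]
    simpa using h0
  have hdet : Q.det ≠ 0 := by
    intro h
    obtain ⟨u, hu0, hu⟩ := Matrix.exists_vecMul_eq_zero_iff.2 h
    exact hu0 (hker u (by rw [hM, ← Matrix.vecMul_vecMul, hu, Matrix.zero_vecMul]))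
  refine ⟨Q, ⟨?_, hdet, hM⟩, ?_⟩
  · ext i j
    rw [Matrix.transpose_apply, hQ, LinearMap.toMatrix_apply, LinearMap.toMatrix_apply,
      OrthonormalBasis.coe_toBasis_repr_apply, OrthonormalBasis.coe_toBasis_repr_apply,
      OrthonormalBasis.repr_apply_apply, OrthonormalBasis.repr_apply_apply,
      OrthonormalBasis.coe_toBasis, real_inner_comm]
    exact hLs (b i) (b j)
  · rintro Q' ⟨-, -, hM'⟩
    rw [← sub_eq_zero]
    have hD : (Q' - Q) * Parallelohedra.columnMatrix p = 0 := by
      rw [Matrix.sub_mul, ← hM, ← hM', sub_self]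
    have hunit : IsUnit Q.det := isUnit_iff_ne_zero.2 hdet
    -- Substituting `P = Q⁻¹ M` turns a relation on `P` into one on `M`, where independence of the
    -- rows applies.
    have hX : (Q' - Q) * Q⁻¹ * Parallelohedra.columnMatrix m = 0 := by
      rw [hM, Matrix.mul_assoc, ← Matrix.mul_assoc Q⁻¹, Matrix.nonsing_inv_mul _ hunit,
        Matrix.one_mul, hD]
    have hX0 : (Q' - Q) * Q⁻¹ = 0 := by
      refine funext fun i => ?_
      refine hker _ ?_
      rw [← Matrix.mul_apply_eq_vecMul, hX]
      rfl
    calc Q' - Q = (Q' - Q) * Q⁻¹ * Q := by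
          rw [Matrix.mul_assoc, Matrix.nonsing_inv_mul _ hunit, Matrix.mul_one]
      _ = 0 := by rw [hX0, Matrix.zero_mul]
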